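/- Let $d\ge 2$ and $N\ge 0$ be integers. Let $(\mathbb R^{d})^N_{\neq}\subset(\mathbb R^d)^N$ be the open set of ordered configurations $(x_1,\dots,x_N)$ with pairwise distinct $x_i$, let ${}^N\mathbb R^d$ be the Riemannian manifold of all $N$-element subsets of $\mathbb R^d$, and let $\pi:(\mathbb R^{d})^N_{\neq}\to{}^N\mathbb R^d$, $\pi(x_1,\dots,x_N)=\{x_1,\dots,x_N\}$, be the covering map (a local isometry). Let $dq$ be the Riemannian volume measure of ${}^N\mathbb R^d$. A Hermitian line bundle is a smooth complex line bundle with a smooth Hermitian metric and a smooth complex-linear connection that is compatible with the metric. Let $F$ be a fermionic line bundle over ${}^N\mathbb R^d$, i.e. a Hermitian line bundle such that the holonomy of every piecewise smooth loop $\alpha$ in ${}^N\mathbb R^d$ is multiplication by $(-1)^{\sigma_\alpha}$, the sign of the permutation $\sigma_\alpha$ of $\alpha(0)$ that $\alpha$ defines. Let $\hat F=\pi_*F$ be its lift (pull-back) to $(\mathbb R^{d})^N_{\neq}$, with fibers $\hat F_{\hat q}=F_{\pi(\hat q)}$, and let $\hat I:\hat F\to(\mathbb R^{d})^N_{\neq}\times\mathbb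 C$ be any global trivialization of $\hat F$ as a Hermitian bundle, i.e. a smooth family of unitary maps $\hat I_{\hat q}:F_{\pi(\hat q)}\to\mathbb C$ that takes parallel transport in $\hat F$ to the identity of $\mathbb C$. Let $L^2(F)$ be the space of measurable cross-sections $\psi$ of $F$ with $\int dq\,\|\psi(q)\|^2<\infty$, modulo equality almost everywhere, with inner product $\langle\phi,\psi\rangle=\int dq\,\langle\phi(q),\psi(q)\rangle_q$. Let $\mathrm{Anti}\,L^2(\mathbb R^{Nd})$ be the space of the $\hat\psi\in L^2((\mathbb R^d)^N,\mathbb C)$ such that, for every permutation $\sigma$, $\hat\psi(x_{\sigma(1)},\dots,x_{\sigma(N)})=(-1)^\sigma\hat\psi(x_1,\dots,x_N)$ for almost every $x$. For Borel sets $A\subseteq{}^N\mathbb R^d$ put $$(Q_F(A)\psi)(q)=1_A(q)\,\psi(q)\quad(\psi\in L^2(F)),\qquad (Q_{\mathrm{Anti}}(A)\hat\psi)(\hat q)=1_{\pi^{-1}(A)}(\hat q)\,\hat\psi(\hat q)\quad(\hat\psi\in\mathrm{Anti}\,L^2(\mathbb R^{Nd})).$$ **Proposition.** The formula $$(U\psi)(x_1,\dots,x_N)=\frac1{\sqrt{N!}}\,\hat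 I_{(x_1,\dots,x_N)}\,\psi(\{x_1,\dots,x_N\})\quad\text{for almost every }(x_1,\dots,x_N)$$ defines a unitary isomorphism $U:L^2(F)\to\mathrm{Anti}\,L^2(\mathbb R^{Nd})$; $Q_F$ and $Q_{\mathrm{Anti}}$ are projection-valued measures on ${}^N\mathbb R^d$ acting on $L^2(F)$ and on $\mathrm{Anti}\,L^2(\mathbb R^{Nd})$, respectively; and $$Q_F(A)=U^{-1}\,Q_{\mathrm{Anti}}(A)\,U\qquad\text{for every Borel set }A\subseteq{}^N\mathbb R^d .$$ -/

import Mathlib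

universe u
open MeasureTheory Set Filter Topology Bundle
open scoped Manifold ContDiff

/-- The one-particle space `ℝ^d`. -/
abbrev Pt (d : ℕ) : Type := EuclideanSpace ℝ (Fin d)

/-- `(ℝ^d)^N = ℝ^{Nd}`. -/
abbrev Tup (d N : ℕ) : Type := Fin N → Pt d

/-- Tuples of pairwise distinct points form an open subset of `(ℝ^d)^N`. -/
theorem isOpen_injective (d N : ℕ) : IsOpen {x : Tup d N | Function.Injective x} := by
  have : {x : Tup d N | Function.Injective x} =
      ⋂ i : Fin N, ⋂ j : Fin N, {x | i ≠ j → x i ≠ x j} := by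
    ext x
    simp only [mem_ofPred_eq, mem_iInter, Function.Injective]
    grind
  rw [this]
  refine isOpen_iInter_of_finite fun i => isOpen_iInter_of_finite fun j => ?_
  by_cases h : i = j
  · simp [h]
  · simpa [h] using isOpen_ne_fun (continuous_apply i) (continuous_apply j)

/-- Ordered configurations without collisions, as an open subset of `(ℝ^d)^N`. -/
def oconfOpens (d N : ℕ) : TopologicalSpace.Opens (Tup d N) :=
  ⟨{x | Function.Injective x}, isOpen_injective d N⟩

/-- The space of ordered configurations without collisions, an open submanifold of `(ℝ^d)^N`. -/
abbrev OConf (d N : ℕ) : Type := oconfOpens d N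

/-- Unordered configurations: `N`-element subsets of `ℝ^d`. -/
def UConf (d N : ℕ) : Type := {S : Finset (Pt d) // S.card = N}

section Conf
variable {d N : ℕ}

theorem OConf.injective (x : OConf d N) : Function.Injective x.1 := x.2

/-- The projection `(x₁, …, x_N) ↦ {x₁, …, x_N}`. -/
def proj (x : OConf d N) : UConf d N :=
  ⟨Finset.univ.map ⟨x.1, x.injective⟩, by simp⟩

theorem mem_proj {x : OConf d N} {y : Pt d} : y ∈ (proj x).1 ↔ ∃ i, x.1 i = y := by
  simp only [proj, Finset.mem_map, Finset.mem_univ, true_and]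
  rfl

/-- Unordered configuration space carries the quotient topology. -/
noncomputable instance : TopologicalSpace (UConf d N) := TopologicalSpace.coinduced proj inferInstance

noncomputable instance : MeasurableSpace (UConf d N) := borel _
instance : BorelSpace (UConf d N) := ⟨rfl⟩

instance : LocallyCompactSpace (OConf d N) :=
  (oconfOpens d N).isOpenEmbedding'.locallyCompactSpace

theorem proj_surjective : Function.Surjective (proj : OConf d N → UConf d N) := by
  rintro ⟨S, hS⟩
  subst hS
  have hinj : Function.Injective (fun i => (S.equivFin.symm i : Pt d)) :=
    Subtype.val_injective.comp S.equivFin.symm.injective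
  refine ⟨⟨_, hinj⟩, Subtype.ext (Finset.ext fun y => mem_proj.trans ⟨?_, fun hy => ?_⟩)⟩
  · rintro ⟨i, rfl⟩
    exact (S.equivFin.symm i).2
  · exact ⟨S.equivFin ⟨y, hy⟩, by simp⟩

/-- Permutations of the labels: `(σ • x) i = x (σ⁻¹ i)`. -/
instance : MulAction (Equiv.Perm (Fin N)) (OConf d N) where
  smul σ x := ⟨x.1 ∘ (σ⁻¹ : Equiv.Perm (Fin N)), x.2.comp (Equiv.injective _)⟩
  one_smul _ := rfl
  mul_smul σ τ x := by
    apply Subtype.ext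
    change x.1 ∘ ((σ * τ)⁻¹ : Equiv.Perm (Fin N)) = _
    rw [mul_inv_rev]
    rfl

theorem perm_smul_val (σ : Equiv.Perm (Fin N)) (x : OConf d N) :
    (σ • x).1 = x.1 ∘ (σ⁻¹ : Equiv.Perm (Fin N)) := rfl

instance : ContinuousConstSMul (Equiv.Perm (Fin N)) (OConf d N) where
  continuous_const_smul σ := by
    refine Continuous.subtype_mk ?_ _
    exact continuous_pi fun i => (continuous_apply _).comp continuous_subtype_val

theorem proj_eq_iff {x y : OConf d N} :
    proj x = proj y ↔ x ∈ MulAction.orbit (Equiv.Perm (Fin N)) y := by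
  constructor
  · intro h
    have hr : Set.range x.1 = Set.range y.1 := by
      ext z
      have := congrArg (fun q : UConf d N => z ∈ q.1) h
      simpa only [mem_proj, eq_iff_iff, mem_range] using this
    let τ : Equiv.Perm (Fin N) :=
      (Equiv.ofInjective x.1 x.injective).trans
        ((Equiv.setCongr hr).trans (Equiv.ofInjective y.1 y.injective).symm)
    refine ⟨τ⁻¹, Subtype.ext (funext fun i => ?_)⟩
    change y.1 ((Equiv.ofInjective y.1 y.injective).symm _) = x.1 i
    exact Equiv.apply_ofInjective_symm y.injective _
  · rintro ⟨σ, rfl⟩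
    refine Subtype.ext (Finset.ext fun z => mem_proj.trans (Iff.trans ?_ mem_proj.symm))
    exact ⟨fun ⟨i, hi⟩ => ⟨_, hi⟩, fun ⟨i, hi⟩ => ⟨σ i, by simpa [perm_smul_val] using hi⟩⟩

instance : IsCancelSMul (Equiv.Perm (Fin N)) (OConf d N) where
  right_cancel' σ τ x h := by
    have h' : x.1 ∘ (σ⁻¹ : Equiv.Perm (Fin N)) = x.1 ∘ (τ⁻¹ : Equiv.Perm (Fin N)) :=
      congrArg Subtype.val h
    have : σ⁻¹ = τ⁻¹ := Equiv.ext fun i => x.2 (congrFun h' i)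
    exact inv_injective this

theorem isQuotientMap_proj : IsQuotientMap (proj : OConf d N → UConf d N) :=
  ⟨⟨rfl⟩, proj_surjective⟩

theorem isQuotientCoveringMap_proj :
    IsQuotientCoveringMap (proj : OConf d N → UConf d N) (Equiv.Perm (Fin N)) :=
  isQuotientMap_proj.isQuotientCoveringMap_of_properlyDiscontinuousSMul proj_eq_iff

theorem isLocalHomeomorph_proj : IsLocalHomeomorph (proj : OConf d N → UConf d N) :=
  isQuotientCoveringMap_proj.isCoveringMap.isLocalHomeomorph

instance : SecondCountableTopology (UConf d N) :=
  isQuotientMap_proj.secondCountableTopology isLocalHomeomorph_proj.isOpenMap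

/-- The charts of `UConf d N` are the local inverses of the projection. -/
noncomputable instance : ChartedSpace (Tup d N) (UConf d N) :=
  isLocalHomeomorph_proj.chartedSpace proj_surjective


/-- Two orderings of the same configurations that depend continuously on each other differ locally
by a fixed permutation. -/
theorem eventually_eq_comp_perm {T : Tup d N → Tup d N} {s : Set (Tup d N)} {y : Tup d N}
    (hs : IsOpen s) (hy : y ∈ s) (hT : ContinuousOn T s)
    (hinj : ∀ z ∈ s, Function.Injective z)
    (hperm : ∀ z ∈ s, ∃ σ : Equiv.Perm (Fin N), T z = z ∘ σ) :
    ∃ σ : Equiv.Perm (Fin N), ∀ᶠ z in 𝓝 y, T z = z ∘ σ := by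
  obtain ⟨σ, hσ⟩ := hperm y hy
  refine ⟨σ, ?_⟩
  have hTy : ContinuousAt T y := hT.continuousAt (hs.mem_nhds hy)
  have key : ∀ τ : Equiv.Perm (Fin N), τ ≠ σ → ∀ᶠ z in 𝓝 y, T z ≠ z ∘ τ := by
    intro τ hτ
    have hne : T y ≠ y ∘ τ := by
      rw [hσ]
      intro h
      exact hτ (Equiv.ext fun i => (hinj y hy (congrFun h i)).symm)
    have hc : ContinuousAt (fun z : Tup d N => z ∘ τ) y :=
      (continuous_pi fun i => continuous_apply (τ i)).continuousAt
    exact (hTy.ne_iff_eventually_ne hc).1 hne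
  have := (Filter.eventually_all (l := 𝓝 y)
    (p := fun (τ : Equiv.Perm (Fin N)) z => τ ≠ σ → T z ≠ z ∘ τ)).2 (fun τ => by
      by_cases h : τ = σ
      · simp [h]
      · simpa [h] using key τ h)
  filter_upwards [this, hs.mem_nhds hy] with z hz hzs
  obtain ⟨τ, hτ⟩ := hperm z hzs
  by_cases h : τ = σ
  · rw [hτ, h]
  · exact absurd hτ (hz τ h)

theorem proj_chart_symm {e : OpenPartialHomeomorph (UConf d N) (Tup d N)}
    (he : e ∈ atlas (Tup d N) (UConf d N)) {z : Tup d N} (hz : z ∈ e.target) :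
    ∃ h : Function.Injective z, e.symm z = proj ⟨z, h⟩ := by
  obtain ⟨q, rfl⟩ := he
  set c := chartAt (Tup d N) (proj_surjective.hasRightInverse.choose q) with hc
  have hzc : z ∈ c.target := hz.1
  have hv : (c.symm z).1 = z := c.right_inv hzc
  have hinj : Function.Injective z := hv ▸ (c.symm z).2
  refine ⟨hinj, ?_⟩
  have hval : c.symm z = ⟨z, hinj⟩ := Subtype.ext hv
  simp [OpenPartialHomeomorph.trans_symm_eq_symm_trans_symm, hval]

theorem isManifold_uconf : IsManifold 𝓘(ℝ, Tup d N) ∞ (UConf d N) := by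
  refine isManifold_of_contDiffOn _ _ _ fun e e' he he' => ?_
  simp only [modelWithCornersSelf_coe, modelWithCornersSelf_coe_symm, Function.comp_id,
    Function.id_comp, preimage_id_eq, id_eq, range_id, inter_univ]
  set T := e.symm ≫ₕ e' with hT
  have hinj : ∀ z ∈ T.source, Function.Injective z := by
    intro z hz
    exact (proj_chart_symm he (by simp [hT] at hz; exact hz.1)).1
  intro y hy
  obtain ⟨σ, hσ⟩ := eventually_eq_comp_perm T.open_source hy T.continuousOn hinj (by
    intro z hz
    have hz' := T.map_source hz
    simp only [hT, OpenPartialHomeomorph.trans_source, OpenPartialHomeomorph.symm_source, mem_inter_iff, mem_preimage, OpenPartialHomeomorph.trans_target, OpenPartialHomeomorph.symm_target] at hz hz'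
    obtain ⟨h1, h1'⟩ := proj_chart_symm he hz.1
    obtain ⟨h2, h2'⟩ := proj_chart_symm he' hz'.1
    have : proj ⟨_, h2⟩ = proj ⟨_, h1⟩ := by
      rw [← h1', ← h2']
      simp [hz.2]
    obtain ⟨τ, hτ⟩ := proj_eq_iff.1 this
    exact ⟨τ⁻¹, (congrArg Subtype.val hτ).symm⟩)
  have hs : ContDiff ℝ ∞ (fun z : Tup d N => z ∘ σ) :=
    contDiff_pi.2 fun i => contDiff_apply ℝ (Pt d) (σ i)
  exact (hs.contDiffAt.congr_of_eventuallyEq hσ).contDiffWithinAt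

instance : IsManifold 𝓘(ℝ, Tup d N) ∞ (UConf d N) := isManifold_uconf
instance : IsManifold 𝓘(ℝ, Tup d N) 1 (UConf d N) := .of_le (n := ∞) (by simp)

/-- Relabelling the particles preserves Lebesgue measure. -/
theorem measurePreserving_perm (σ : Equiv.Perm (Fin N)) :
    MeasurePreserving (fun x : Tup d N => x ∘ σ) volume volume := by
  have h := volume_measurePreserving_piCongrLeft (fun _ : Fin N => Pt d) σ.symm
  convert h using 1
  funext x i
  have := Equiv.piCongrLeft_apply_apply (P := fun _ : Fin N => Pt d) σ.symm x (σ i)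
  simp only [Equiv.symm_apply_apply] at this
  exact this.symm

theorem measurable_proj : Measurable (proj : OConf d N → UConf d N) :=
  isLocalHomeomorph_proj.continuous.measurable

theorem measurableEmbedding_val : MeasurableEmbedding (Subtype.val : OConf d N → Tup d N) :=
  MeasurableEmbedding.subtype_coe (oconfOpens d N).2.measurableSet

/-- Lebesgue measure on the open set of ordered configurations. -/
noncomputable instance : MeasureSpace (OConf d N) where
  volume := Measure.comap Subtype.val (volume : Measure (Tup d N))

/-- The Riemannian volume measure of unordered configuration space: `proj` is a local isometry and
`N!`-to-one, so its image measure counts every region `N!` times (see `volume_image_proj`). -/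
noncomputable instance : MeasureSpace (UConf d N) where
  volume := ((N.factorial : ENNReal)⁻¹) • Measure.map proj (volume : Measure (OConf d N))

/-- `proj` preserves the volume of every open set on which it is injective. -/
theorem volume_image_proj {V : Set (OConf d N)} (hV : IsOpen V) (hinj : InjOn proj V) :
    volume (proj '' V) = volume V := by
  have hO : IsOpen (proj '' V) := isLocalHomeomorph_proj.isOpenMap _ hV
  have hpre : proj ⁻¹' (proj '' V) =
      ⋃ σ : Equiv.Perm (Fin N), (fun x : OConf d N => σ • x) ⁻¹' V := by
    ext x
    simp only [mem_preimage, mem_image, mem_iUnion]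
    constructor
    · rintro ⟨y, hy, hxy⟩
      obtain ⟨σ, hσ⟩ := proj_eq_iff.1 hxy
      exact ⟨σ, by simpa [hσ] using hy⟩
    · rintro ⟨σ, hσ⟩
      exact ⟨_, hσ, proj_eq_iff.2 ⟨σ, rfl⟩⟩
  have hdisj : Pairwise (Function.onFun Disjoint
      fun σ : Equiv.Perm (Fin N) => (fun x : OConf d N => σ • x) ⁻¹' V) := by
    intro σ τ hne
    refine Set.disjoint_left.2 fun x hx hx' => hne ?_
    have : proj (σ • x) = proj (τ • x) := by
      rw [isQuotientCoveringMap_proj.map_smul, isQuotientCoveringMap_proj.map_smul]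
    exact IsCancelSMul.right_cancel _ _ _ (hinj hx hx' this)
  have hvol : ∀ σ : Equiv.Perm (Fin N),
      volume ((fun x : OConf d N => σ • x) ⁻¹' V) = volume V := by
    intro σ
    change Measure.comap Subtype.val (volume : Measure (Tup d N)) _ = Measure.comap Subtype.val (volume : Measure (Tup d N)) _
    rw [measurableEmbedding_val.comap_apply volume,
      measurableEmbedding_val.comap_apply volume]
    have : Subtype.val '' ((fun x : OConf d N => σ • x) ⁻¹' V) =
        (fun x : Tup d N => x ∘ (σ⁻¹ : Equiv.Perm (Fin N))) ⁻¹' (Subtype.val '' V) := by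
      ext x
      constructor
      · rintro ⟨y, hy, rfl⟩
        exact ⟨_, hy, rfl⟩
      · rintro ⟨y, hy, hyx⟩
        refine ⟨σ⁻¹ • y, by simpa using hy, ?_⟩
        rw [perm_smul_val, hyx]
        funext i
        simp
    rw [this, (measurePreserving_perm _).measure_preimage]
    exact (measurableEmbedding_val.measurableSet_image.2 hV.measurableSet).nullMeasurableSet
  change ((N.factorial : ENNReal)⁻¹) • Measure.map proj (volume : Measure (OConf d N)) _ = _
  rw [Measure.map_apply measurable_proj hO.measurableSet, hpre,
    measure_iUnion hdisj fun σ => (hV.preimage (continuous_const_smul σ)).measurableSet]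
  simp only [hvol, tsum_fintype, Finset.sum_const, Finset.card_univ, Fintype.card_perm,
    Fintype.card_fin, smul_eq_mul, nsmul_eq_mul]
  rw [← mul_assoc, ENNReal.inv_mul_cancel (by simp [Nat.factorial_ne_zero]) (by simp), one_mul]

end Conf

section Bundle
variable {d N : ℕ}

/-- `ψ` is smooth on `O`, as a map into the total space. -/
def SmoothSectionOn (V : UConf d N → Type u) [∀ q, TopologicalSpace (V q)]
    [TopologicalSpace (TotalSpace ℂ V)] [FiberBundle ℂ V] (ψ : ∀ q, V q)
    (O : Set (UConf d N)) : Prop :=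
  ContMDiffOn 𝓘(ℝ, Tup d N) (𝓘(ℝ, Tup d N).prod 𝓘(ℝ, ℂ)) ∞
    (fun q => TotalSpace.mk' ℂ q (ψ q)) O

/-- `ψ` is smooth near `q`. -/
def SmoothSectionAt (V : UConf d N → Type u) [∀ q, TopologicalSpace (V q)]
    [TopologicalSpace (TotalSpace ℂ V)] [FiberBundle ℂ V] (ψ : ∀ q, V q)
    (q : UConf d N) : Prop :=
  ∃ O, IsOpen O ∧ q ∈ O ∧ SmoothSectionOn V ψ O

/-- A Hermitian line bundle over `UConf d N`: a smooth complex line bundle with a smooth Hermitian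
fibre metric and a smooth complex linear connection for which the metric is parallel. -/
structure HermitianLineBundle (d N : ℕ) where
  /-- The fibre over `q`, with its Hermitian inner product. -/
  Fiber : UConf d N → Type u
  [normed : ∀ q, NormedAddCommGroup (Fiber q)]
  [innerProduct : ∀ q, InnerProductSpace ℂ (Fiber q)]
  [topTotal : TopologicalSpace (TotalSpace ℂ Fiber)]
  [fiberBundle : FiberBundle ℂ Fiber]
  [vectorBundleComplex : VectorBundle ℂ ℂ Fiber]
  [vectorBundleReal : VectorBundle ℝ ℂ Fiber]
  [smoothBundle : ContMDiffVectorBundle ∞ ℂ Fiber 𝓘(ℝ, Tup d N)]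
  smooth_inner : ∀ O : Set (UConf d N), IsOpen O → ∀ φ ψ : ∀ q, Fiber q,
    SmoothSectionOn Fiber φ O → SmoothSectionOn Fiber ψ O →
    ContMDiffOn 𝓘(ℝ, Tup d N) 𝓘(ℝ, ℂ) ∞ (fun q => inner ℂ (φ q) (ψ q)) O
  /-- The connection; `conn ψ q v` is the covariant derivative of `ψ` at `q` along `v`. -/
  conn : CovariantDerivative 𝓘(ℝ, Tup d N) ℂ Fiber
  conn_smooth : conn.ContMDiffCovariantDerivative ∞
  conn_complex : ∀ (c : ℂ) (ψ : ∀ q, Fiber q) (q : UConf d N), SmoothSectionAt Fiber ψ q →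
    ∀ v, conn (c • ψ) q v = c • conn ψ q v
  conn_metric : ∀ (φ ψ : ∀ q, Fiber q) (q : UConf d N),
    SmoothSectionAt Fiber φ q → SmoothSectionAt Fiber ψ q →
    ∀ v, mfderiv 𝓘(ℝ, Tup d N) 𝓘(ℝ, ℂ) (fun q => (inner ℂ (φ q) (ψ q) : ℂ)) q v =
      (inner ℂ (conn φ q v) (ψ q) + inner ℂ (φ q) (conn ψ q v) : ℂ)

attribute [instance] HermitianLineBundle.normed HermitianLineBundle.innerProduct
  HermitianLineBundle.topTotal HermitianLineBundle.fiberBundle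
  HermitianLineBundle.vectorBundleComplex HermitianLineBundle.vectorBundleReal
  HermitianLineBundle.smoothBundle

/-- A partition `0 = t 0 < t 1 < … < t n = 1` of the unit interval. -/
structure UnitPartition where
  /-- The number of pieces. -/
  n : ℕ
  /-- The division points (only `t 0, …, t n` matter). -/
  t : ℕ → ℝ
  t_zero : t 0 = 0
  t_last : t n = 1
  t_lt : ∀ i < n, t i < t (i + 1)

/-- The closed pieces of the partition. -/
def UnitPartition.piece (P : UnitPartition) (i : ℕ) : Set ℝ := Icc (P.t i) (P.t (i + 1))

/-- The curve `β : [0,1] → M` is smooth on each closed piece of `P`. -/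
def SmoothOnPieces (d N : ℕ) {M : Type*} [TopologicalSpace M] [ChartedSpace (Tup d N) M]
    (P : UnitPartition) (β : ℝ → M) : Prop :=
  ∀ i < P.n, ContMDiffOn 𝓘(ℝ, ℝ) 𝓘(ℝ, Tup d N) ∞ β (P.piece i)

/-- `w` is the covariant derivative at time `t`, within `J`, of the section `s` along the curve `α`:
near `t` one has `s = f · (ψ ∘ α)` with a smooth section `ψ` and a scalar function `f`, and
`w = f'(t) ψ(α t) + f(t) ∇_{α'(t)} ψ`. -/
def HasCovDerivWithinAt (F : HermitianLineBundle.{u} d N) (α : ℝ → UConf d N)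
    (s : ∀ t, F.Fiber (α t)) (J : Set ℝ) (t : ℝ) (w : F.Fiber (α t)) : Prop :=
  ∃ (ψ : ∀ q, F.Fiber q) (f : ℝ → ℂ) (f' : ℂ),
    SmoothSectionAt F.Fiber ψ (α t) ∧ HasDerivWithinAt f f' J t ∧
    (∀ᶠ r in 𝓝[J] t, s r = f r • ψ (α r)) ∧
    w = f' • ψ (α t) +
      f t • F.conn ψ (α t) (mfderivWithin 𝓘(ℝ, ℝ) 𝓘(ℝ, Tup d N) α J t (1 : ℝ))

/-- The section `s` along the piecewise smooth curve `α` is parallel. -/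
def IsParallelAlong (F : HermitianLineBundle.{u} d N) (P : UnitPartition) (α : ℝ → UConf d N)
    (s : ∀ t, F.Fiber (α t)) : Prop :=
  ∀ i < P.n, ∀ t ∈ P.piece i, HasCovDerivWithinAt F α s (P.piece i) t 0

/-- Parallel transport once around the closed curve `α` is multiplication by `c`. -/
def HasHolonomy (F : HermitianLineBundle.{u} d N) (P : UnitPartition) (α : ℝ → UConf d N)
    (c : ℂ) : Prop :=
  ∀ v : F.Fiber (α 0), ∃ s : ∀ t, F.Fiber (α t), IsParallelAlong F P α s ∧ s 0 = v ∧
    TotalSpace.mk' ℂ (α 1) (s 1) = TotalSpace.mk' ℂ (α 0) (c • v)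

/-- `τ` is the permutation of the configuration `α 0` defined by the closed curve `α`: the curve
consists of `N` curves in `ℝ^d`, the one starting at the point `x` of `α 0` ending at `τ x`. -/
def DefinesPerm (α : ℝ → UConf d N) (τ : Equiv.Perm (α 0).1) : Prop :=
  ∃ c : (α 0).1 → ℝ → Pt d, (∀ x, ContinuousOn (c x) (Icc 0 1)) ∧ (∀ x, c x 0 = x) ∧
    (∀ x, c x 1 = τ x) ∧ ∀ t ∈ Icc (0 : ℝ) 1, ((α t).1 : Set (Pt d)) = range fun x => c x t

open Classical in
/-- The defining property of the fermionic line bundle: the holonomy of every piecewise smooth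
closed curve is the sign of the permutation that the curve defines. -/
def IsFermionic (F : HermitianLineBundle.{u} d N) : Prop :=
  ∀ (P : UnitPartition) (α : ℝ → UConf d N), SmoothOnPieces d N P α → α 1 = α 0 →
    ∀ τ : Equiv.Perm (α 0).1, DefinesPerm α τ → HasHolonomy F P α ((Equiv.Perm.sign τ : ℤ) : ℂ)

/-- A global trivialization, as a Hermitian bundle, of the lift of `F` to the ordered configurations,
whose fibre over `x` is `F.Fiber (proj x)` and whose parallel transport along a curve `β` is that of
`F` along `proj ∘ β`: a smooth family of unitary maps from the fibres to `ℂ` that takes parallel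
transport to the identity. -/
structure LiftTrivialization (F : HermitianLineBundle.{u} d N) where
  /-- The unitary map from the fibre over `x` to `ℂ`. -/
  toFun : ∀ x : OConf d N, F.Fiber (proj x) ≃ₗᵢ[ℂ] ℂ
  smooth : ∀ (O : Set (UConf d N)) (ψ : ∀ q, F.Fiber q), IsOpen O → SmoothSectionOn F.Fiber ψ O →
    ContMDiffOn 𝓘(ℝ, Tup d N) 𝓘(ℝ, ℂ) ∞ (fun x => toFun x (ψ (proj x))) (proj ⁻¹' O)
  parallel : ∀ (P : UnitPartition) (β : ℝ → OConf d N), SmoothOnPieces d N P β →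
    ∀ s : (∀ t, F.Fiber (proj (β t))), IsParallelAlong F P (fun t => proj (β t)) s →
      toFun (β 1) (s 1) = toFun (β 0) (s 0)

/-! ### Square-integrable sections -/

/-- Measurability of a section, in the local trivializations of the bundle. -/
def MeasurableSection (F : HermitianLineBundle.{u} d N) (ψ : ∀ q, F.Fiber q) : Prop :=
  ∀ (e : Trivialization ℂ (π ℂ F.Fiber)) [MemTrivializationAtlas e],
    Measurable fun q : e.baseSet => (e ⟨q, ψ q⟩).2

theorem MeasurableSection.add {F : HermitianLineBundle.{u} d N} {φ ψ : ∀ q, F.Fiber q}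
    (hφ : MeasurableSection F φ) (hψ : MeasurableSection F ψ) : MeasurableSection F (φ + ψ) := by
  intro e he
  convert (hφ e).add (hψ e) using 1
  funext q
  exact ((e.linear ℂ q.2).map_add (φ q) (ψ q))

theorem MeasurableSection.smul {F : HermitianLineBundle.{u} d N} {ψ : ∀ q, F.Fiber q}
    (c : ℂ) (hψ : MeasurableSection F ψ) : MeasurableSection F (c • ψ) := by
  intro e he
  convert (hψ e).const_smul c using 1
  funext q
  exact ((e.linear ℂ q.2).map_smul c (ψ q))

theorem MeasurableSection.zero {F : HermitianLineBundle.{u} d N} :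
    MeasurableSection F (0 : ∀ q, F.Fiber q) := by
  intro e he
  convert measurable_const (a := (0 : ℂ)) using 1
  funext q
  exact ((e.linear ℂ q.2).map_zero)

theorem MeasurableSection.indicator {F : HermitianLineBundle.{u} d N} {ψ : ∀ q, F.Fiber q}
    (hψ : MeasurableSection F ψ) {A : Set (UConf d N)} (hA : MeasurableSet A) :
    MeasurableSection F fun q => A.indicator (1 : UConf d N → ℂ) q • ψ q := by
  intro e he
  have h1 : Measurable fun q : e.baseSet => A.indicator (1 : UConf d N → ℂ) q :=
    (measurable_one.indicator hA).comp measurable_subtype_coe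
  convert h1.mul (hψ e) using 1
  funext q
  exact ((e.linear ℂ q.2).map_smul _ (ψ q))

theorem MeasurableSection.inner {F : HermitianLineBundle.{u} d N} {φ ψ : ∀ q, F.Fiber q}
    (hφ : MeasurableSection F φ) (hψ : MeasurableSection F ψ) :
    Measurable fun q => (inner ℂ (φ q) (ψ q) : ℂ) := by
  have loc : ∀ p : UConf d N, Measurable fun q : (trivializationAt ℂ F.Fiber p).baseSet =>
      (Inner.inner ℂ (φ q) (ψ q) : ℂ) := by
    intro p
    set e := trivializationAt ℂ F.Fiber p
    have hs : SmoothSectionOn F.Fiber (fun q => e.symm q (1 : ℂ)) e.baseSet := by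
      refine (e.contMDiffOn_section_baseSet_iff (IB := 𝓘(ℝ, Tup d N)) (n := ∞)).2 ?_
      refine (contMDiffOn_const (c := (1 : ℂ))).congr fun q hq => ?_
      rw [e.apply_mk_symm hq]
    have hc := (F.smooth_inner _ e.open_baseSet _ _ hs hs).continuousOn
    have hm := (continuousOn_iff_continuous_domRestrict.1 hc).measurable
    have key : ∀ χ : (∀ q, F.Fiber q), ∀ q ∈ e.baseSet,
        χ q = (e ⟨q, χ q⟩).2 • e.symm q (1 : ℂ) := by
      intro χ q hq
      have h := e.symm_apply_apply_mk hq (χ q)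
      have h2 := e.symm_apply_apply_mk hq ((e ⟨q, χ q⟩).2 • e.symm q (1 : ℂ))
      have h3 : (e ⟨q, (e ⟨q, χ q⟩).2 • e.symm q (1 : ℂ)⟩).2 = (e ⟨q, χ q⟩).2 := by
        refine ((e.linear ℂ hq).map_smul _ (e.symm q (1 : ℂ))).trans ?_
        rw [e.apply_mk_symm hq, smul_eq_mul, mul_one]
      rw [h3] at h2
      exact h.symm.trans h2
    convert ((continuous_star.measurable.comp (hφ e)).mul (hψ e)).mul hm using 1
    funext q
    change Inner.inner ℂ (φ q) (ψ q) = star (e ⟨q, φ q⟩).2 * (e ⟨q, ψ q⟩).2 *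
      Inner.inner ℂ (e.symm q (1 : ℂ)) (e.symm q (1 : ℂ))
    conv_lhs => rw [key φ q q.2, key ψ q q.2, inner_smul_left, inner_smul_right]
    simp [mul_assoc]
  obtain ⟨s, hs, hcov⟩ := TopologicalSpace.countable_cover_nhds
    (fun p : UConf d N => (trivializationAt ℂ F.Fiber p).open_baseSet.mem_nhds
      (FiberBundle.mem_baseSet_trivializationAt' p))
  intro T hT
  have : (fun q => (Inner.inner ℂ (φ q) (ψ q) : ℂ)) ⁻¹' T = ⋃ p ∈ s, Subtype.val ''
      ((fun q : (trivializationAt ℂ F.Fiber p).baseSet =>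
        (Inner.inner ℂ (φ q) (ψ q) : ℂ)) ⁻¹' T) := by
    ext q
    have hq : q ∈ ⋃ p ∈ s, (trivializationAt ℂ F.Fiber p).baseSet := hcov ▸ mem_univ q
    simp only [mem_iUnion] at hq
    simp only [mem_preimage, mem_iUnion, mem_image, Subtype.exists]
    constructor
    · intro h
      obtain ⟨p, hp, hqp⟩ := hq
      exact ⟨p, hp, q, hqp, h, rfl⟩
    · rintro ⟨p, hp, q', hqp, h, rfl⟩
      exact h
  rw [this]
  exact .biUnion hs fun p _ =>
    (trivializationAt ℂ F.Fiber p).open_baseSet.measurableSet.subtype_image (loc p hT)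


theorem MeasurableSection.normSq {F : HermitianLineBundle.{u} d N} {ψ : ∀ q, F.Fiber q}
    (hψ : MeasurableSection F ψ) : Measurable fun q => ‖ψ q‖ ^ 2 := by
  convert Complex.measurable_re.comp (hψ.inner hψ) using 1
  funext q
  exact (inner_self_eq_norm_sq (𝕜 := ℂ) (ψ q)).symm

/-- The measurable sections `ψ` with `∫ ‖ψ(q)‖² dq < ∞`. -/
def sqIntSections (F : HermitianLineBundle.{u} d N) : Submodule ℂ (∀ q, F.Fiber q) where
  carrier := {ψ | MeasurableSection F ψ ∧ Integrable fun q => ‖ψ q‖ ^ 2}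
  zero_mem' := ⟨.zero, by simp⟩
  add_mem' {φ ψ} hφ hψ := by
    refine ⟨hφ.1.add hψ.1, ?_⟩
    refine ((hφ.2.const_mul 2).add (hψ.2.const_mul 2)).mono'
      (hφ.1.add hψ.1).normSq.aestronglyMeasurable (ae_of_all _ fun q => ?_)
    have h1 := norm_add_le (φ q) (ψ q)
    have h2 := norm_nonneg (φ q + ψ q)
    simp only [Pi.add_apply, Real.norm_eq_abs, abs_pow, abs_norm]
    nlinarith [sq_nonneg (‖φ q‖ - ‖ψ q‖), norm_nonneg (φ q), norm_nonneg (ψ q)]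
  smul_mem' c ψ hψ := by
    refine ⟨hψ.1.smul c, ?_⟩
    simp only [Pi.smul_apply, norm_smul, mul_pow]
    exact hψ.2.const_mul _

/-- Square-integrable sections, before identifying those that agree almost everywhere. -/
def SqIntSection (F : HermitianLineBundle.{u} d N) : Type u := sqIntSections F

namespace SqIntSection
variable {F : HermitianLineBundle.{u} d N}

noncomputable instance : AddCommGroup (SqIntSection F) :=
  inferInstanceAs (AddCommGroup (sqIntSections F))
noncomputable instance : Module ℂ (SqIntSection F) :=
  inferInstanceAs (Module ℂ (sqIntSections F))

instance : CoeFun (SqIntSection F) fun _ => ∀ q, F.Fiber q := ⟨fun ψ => ψ.1⟩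

theorem integrable_inner (φ ψ : SqIntSection F) :
    Integrable fun q => (inner ℂ (φ q) (ψ q) : ℂ) := by
  refine (φ.2.2.add ψ.2.2).mono' (φ.2.1.inner ψ.2.1).aestronglyMeasurable
    (ae_of_all _ fun q => ?_)
  have h := norm_inner_le_norm (𝕜 := ℂ) (φ.1 q) (ψ.1 q)
  simp only [Pi.add_apply]
  nlinarith [sq_nonneg (‖φ.1 q‖ - ‖ψ.1 q‖), sq_nonneg ‖φ.1 q‖, sq_nonneg ‖ψ.1 q‖]

/-- The inner product `⟨φ, ψ⟩ = ∫ ⟨φ(q), ψ(q)⟩ dq`. -/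
@[reducible]
noncomputable def core (F : HermitianLineBundle.{u} d N) :
    PreInnerProductSpace.Core ℂ (SqIntSection F) where
  inner φ ψ := ∫ q, inner ℂ (φ q) (ψ q)
  conj_inner_symm φ ψ := by
    simp only [← integral_conj, inner_conj_symm]
  re_inner_nonneg φ := by
    rw [← integral_re (integrable_inner φ φ)]
    exact integral_nonneg fun q => inner_self_nonneg
  add_left φ ψ χ := by
    rw [← integral_add (integrable_inner φ χ) (integrable_inner ψ χ)]
    exact integral_congr_ae (ae_of_all _ fun q => inner_add_left _ _ _)
  smul_left φ ψ c := by
    rw [← integral_const_mul]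
    exact integral_congr_ae (ae_of_all _ fun q => inner_smul_left _ _ _)

noncomputable instance : SeminormedAddCommGroup (SqIntSection F) :=
  @InnerProductSpace.Core.toSeminormedAddCommGroup ℂ (SqIntSection F) _ _ _ (core F)

noncomputable instance : InnerProductSpace ℂ (SqIntSection F) := .ofCore (core F)

theorem norm_sq (ψ : SqIntSection F) : ‖ψ‖ ^ 2 = ∫ q, ‖ψ q‖ ^ 2 := by
  rw [← inner_self_eq_norm_sq (𝕜 := ℂ) ψ]
  change RCLike.re (∫ q, (inner ℂ (ψ q) (ψ q) : ℂ)) = _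
  rw [← integral_re (integrable_inner ψ ψ)]
  exact integral_congr_ae (ae_of_all _ fun q => inner_self_eq_norm_sq _)

/-- Two square-integrable sections are identified in `L²` exactly if they agree almost everywhere. -/
theorem inseparable_iff (φ ψ : SqIntSection F) :
    Inseparable φ ψ ↔ ∀ᵐ q, φ q = ψ q := by
  rw [Metric.inseparable_iff, dist_eq_norm, ← sq_eq_zero_iff, norm_sq,
    integral_eq_zero_iff_of_nonneg (fun q => by positivity) (φ - ψ).2.2]
  refine eventually_congr (ae_of_all _ fun q => ?_)
  change ‖φ.1 q - ψ.1 q‖ ^ 2 = 0 ↔ _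
  rw [sq_eq_zero_iff, norm_eq_zero, sub_eq_zero]

/-- Multiplication of a section by the indicator function of `A`. -/
noncomputable def mulIndicator (A : Set (UConf d N)) (hA : MeasurableSet A) :
    SqIntSection F →L[ℂ] SqIntSection F :=
  LinearMap.mkContinuous
    { toFun := fun ψ => ⟨fun q => A.indicator (1 : UConf d N → ℂ) q • ψ q, ψ.2.1.indicator hA, by
        refine ψ.2.2.mono' (ψ.2.1.indicator hA).normSq.aestronglyMeasurable
          (ae_of_all _ fun q => ?_)
        by_cases h : q ∈ A <;> simp [h]⟩
      map_add' := fun φ ψ => Subtype.ext (funext fun q => smul_add _ _ _)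
      map_smul' := fun c ψ => Subtype.ext (funext fun q => smul_comm _ _ _) } 1 (by
    intro ψ
    rw [one_mul, ← sq_le_sq₀ (norm_nonneg _) (norm_nonneg _), norm_sq, norm_sq]
    refine integral_mono_of_nonneg (ae_of_all _ fun q => by positivity) ψ.2.2
      (ae_of_all _ fun q => ?_)
    change ‖A.indicator (1 : UConf d N → ℂ) q • ψ.1 q‖ ^ 2 ≤ ‖ψ.1 q‖ ^ 2
    by_cases h : q ∈ A <;> simp [h])

end SqIntSection

/-- `L²(F)`: the square-integrable sections of `F` modulo equality almost everywhere. -/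
abbrev L2Section (F : HermitianLineBundle.{u} d N) : Type u := SeparationQuotient (SqIntSection F)

/-- The PVM of `F`: `Q_F(A) ψ = 1_A ψ`. -/
noncomputable def QF (F : HermitianLineBundle.{u} d N) (A : Set (UConf d N))
    (hA : MeasurableSet A) : L2Section F →L[ℂ] L2Section F :=
  SeparationQuotient.liftCLM
    ((SeparationQuotient.mkCLM ℂ (SqIntSection F)).comp (SqIntSection.mulIndicator A hA))
    fun _ _ h => SeparationQuotient.mk_eq_mk.2 (h.map (SqIntSection.mulIndicator A hA).continuous)

end Bundle

/-! ### Anti-symmetric functions -/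

section Anti

variable {X : Type*} [MeasurableSpace X] {μ : Measure X} {s : Set X}

/-- The product of an `L²` function with the indicator function of `s`. -/
noncomputable def lpIndicator (hs : MeasurableSet s) (f : Lp ℂ 2 μ) : Lp ℂ 2 μ :=
  ((Lp.memLp f).indicator hs).toLp (s.indicator f)

theorem coeFn_lpIndicator (hs : MeasurableSet s) (f : Lp ℂ 2 μ) :
    lpIndicator hs f =ᵐ[μ] s.indicator f := by
  unfold lpIndicator
  exact MemLp.coeFn_toLp _

theorem lpIndicator_add (hs : MeasurableSet s) (f g : Lp ℂ 2 μ) :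
    lpIndicator hs (f + g) = lpIndicator hs f + lpIndicator hs g := by
  refine Lp.ext ?_
  filter_upwards [coeFn_lpIndicator hs (f + g), coeFn_lpIndicator hs f, coeFn_lpIndicator hs g,
    Lp.coeFn_add f g, Lp.coeFn_add (lpIndicator hs f) (lpIndicator hs g)] with x h1 h2 h3 h4 h5
  rw [h1, h5, Pi.add_apply, h2, h3]
  by_cases hx : x ∈ s
  · rw [indicator_of_mem hx, indicator_of_mem hx, indicator_of_mem hx, h4, Pi.add_apply]
  · rw [indicator_of_notMem hx, indicator_of_notMem hx, indicator_of_notMem hx, add_zero]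

theorem lpIndicator_smul (hs : MeasurableSet s) (c : ℂ) (f : Lp ℂ 2 μ) :
    lpIndicator hs (c • f) = c • lpIndicator hs f := by
  refine Lp.ext ?_
  filter_upwards [coeFn_lpIndicator hs (c • f), coeFn_lpIndicator hs f,
    Lp.coeFn_smul c f, Lp.coeFn_smul c (lpIndicator hs f)] with x h1 h2 h4 h5
  rw [h1, h5, Pi.smul_apply, h2]
  by_cases hx : x ∈ s
  · rw [indicator_of_mem hx, indicator_of_mem hx, h4, Pi.smul_apply]
  · rw [indicator_of_notMem hx, indicator_of_notMem hx, smul_zero]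

/-- Multiplication by the indicator function of `s` as a bounded operator on `L²`. -/
noncomputable def lpMulIndicator (hs : MeasurableSet s) : Lp ℂ 2 μ →L[ℂ] Lp ℂ 2 μ :=
  LinearMap.mkContinuous
    { toFun := lpIndicator hs
      map_add' := lpIndicator_add hs
      map_smul' := lpIndicator_smul hs } 1 fun f => by
    rw [one_mul]
    refine Lp.norm_le_norm_of_ae_le ?_
    filter_upwards [coeFn_lpIndicator hs f] with x h1
    change ‖lpIndicator hs f x‖ ≤ _
    rw [h1]
    exact norm_indicator_le_norm_self _ _

variable {d N : ℕ}

/-- `Anti L²(ℝ^{Nd})`: the `ψ ∈ L²` with `ψ(x_{σ(1)}, …, x_{σ(N)}) = (-1)^σ ψ(x₁, …, x_N)` for almost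
every `x`, for all permutations `σ`. -/
noncomputable def antiL2 (d N : ℕ) : Submodule ℂ (Lp ℂ 2 (volume : Measure (Tup d N))) where
  carrier := {f | ∀ σ : Equiv.Perm (Fin N),
    (fun x => f (x ∘ σ)) =ᵐ[volume] fun x => ((Equiv.Perm.sign σ : ℤ) : ℂ) * f x}
  zero_mem' σ := by
    have h := Lp.coeFn_zero ℂ 2 (volume : Measure (Tup d N))
    filter_upwards [h, (measurePreserving_perm σ).quasiMeasurePreserving.ae_eq h] with x h1 h2
    simp_all
  add_mem' {f g} hf hg σ := by
    have h := Lp.coeFn_add f g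
    filter_upwards [h, (measurePreserving_perm σ).quasiMeasurePreserving.ae_eq h, hf σ, hg σ]
      with x h1 h2 h3 h4
    simp only [Function.comp_apply, Pi.add_apply] at h1 h2
    rw [h2, h1, h3, h4, mul_add]
  smul_mem' c f hf σ := by
    have h := Lp.coeFn_smul c f
    filter_upwards [h, (measurePreserving_perm σ).quasiMeasurePreserving.ae_eq h, hf σ]
      with x h1 h2 h3
    simp only [Function.comp_apply, Pi.smul_apply, smul_eq_mul] at h1 h2
    rw [h2, h1, h3]
    ring

/-- `π⁻¹(A)` as a subset of `ℝ^{Nd}`. -/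
def projPreimage (A : Set (UConf d N)) : Set (Tup d N) := Subtype.val '' (proj ⁻¹' A)

theorem measurableSet_projPreimage {A : Set (UConf d N)} (hA : MeasurableSet A) :
    MeasurableSet (projPreimage A) :=
  measurableEmbedding_val.measurableSet_image.2 (measurable_proj hA)

theorem perm_mem_projPreimage {A : Set (UConf d N)} (σ : Equiv.Perm (Fin N)) {x : Tup d N} :
    x ∘ σ ∈ projPreimage A ↔ x ∈ projPreimage A := by
  have key : ∀ (τ : Equiv.Perm (Fin N)) (x : Tup d N), x ∈ projPreimage A →
      x ∘ τ ∈ projPreimage A := by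
    rintro τ _ ⟨y, hy, rfl⟩
    refine ⟨τ⁻¹ • y, ?_, by rw [perm_smul_val, inv_inv]⟩
    rwa [mem_preimage, isQuotientCoveringMap_proj.map_smul]
  refine ⟨fun h => ?_, key σ x⟩
  have := key σ⁻¹ _ h
  have hx : (x ∘ σ) ∘ (σ⁻¹ : Equiv.Perm (Fin N)) = x := by
    funext i
    simp
  rwa [hx] at this

/-- The unordered configuration observable: `Q_Anti(A) ψ = 1_{π⁻¹(A)} ψ`. -/
noncomputable def QAnti (d N : ℕ) (A : Set (UConf d N)) (hA : MeasurableSet A) :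
    antiL2 d N →L[ℂ] antiL2 d N :=
  ((lpMulIndicator (measurableSet_projPreimage hA)).comp
    (antiL2 d N).subtypeL).codRestrict (antiL2 d N) (by
    intro f σ
    have h := coeFn_lpIndicator (measurableSet_projPreimage hA) f.1
    filter_upwards [h, (measurePreserving_perm σ).quasiMeasurePreserving.ae_eq h, f.2 σ]
      with x h1 h2 h3
    simp only [Function.comp_apply] at h2
    change (lpIndicator (measurableSet_projPreimage hA) f.1) (x ∘ σ) = _ *
      (lpIndicator (measurableSet_projPreimage hA) f.1) x
    rw [h2, h1]
    by_cases hx : x ∈ projPreimage A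
    · rw [indicator_of_mem hx, indicator_of_mem ((perm_mem_projPreimage σ).2 hx), h3]
    · rw [indicator_of_notMem hx, indicator_of_notMem (mt (perm_mem_projPreimage σ).1 hx),
        mul_zero])

end Anti

/-- A projection-valued measure on `X` acting on `H`. -/
structure IsPVM {X : Type*} [MeasurableSpace X] {H : Type*} [NormedAddCommGroup H]
    [InnerProductSpace ℂ H] (Q : ∀ A : Set X, MeasurableSet A → H →L[ℂ] H) : Prop where
  symmetric : ∀ A hA φ ψ, (inner ℂ (Q A hA φ) ψ : ℂ) = inner ℂ φ (Q A hA ψ)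
  idempotent : ∀ A hA ψ, Q A hA (Q A hA ψ) = Q A hA ψ
  map_univ : Q univ .univ = ContinuousLinearMap.id ℂ H
  map_iUnion : ∀ (A : ℕ → Set X) (hA : ∀ n, MeasurableSet (A n)),
    Pairwise (Function.onFun Disjoint A) →
    ∀ ψ, HasSum (fun n => Q (A n) (hA n) ψ) (Q (⋃ n, A n) (.iUnion hA) ψ)

open Classical in
/-- The function `x ↦ N!^{-1/2} I_x ψ(π(x))` on ordered configurations, extended by zero to the
collision configurations. -/
noncomputable def liftSection {d N : ℕ} {F : HermitianLineBundle.{u} d N}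
    (I : LiftTrivialization F) (ψ : ∀ q, F.Fiber q) (x : Tup d N) : ℂ :=
  if h : Function.Injective x then
    ((1 / Real.sqrt (N.factorial : ℝ) : ℝ) : ℂ) * I.toFun ⟨x, h⟩ (ψ (proj ⟨x, h⟩))
  else 0

/-! ### Smooth curves of ordered configurations and their projections. -/

section Curves
variable {d N : ℕ}

/-! The lift of a section is automatically anti-symmetric, and every anti-symmetric function
descends to a section. Since d ≥ 2, a configuration x and its relabelling σ • x are joined by a
piecewise smooth collision-free curve. It projects to a loop whose permutation is conjugate to σ⁻¹,
so the holonomy of the loop is the sign of σ. The trivialization takes parallel transport along the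
curve to the identity of ℂ, so its values at x and at σ • x on the same fibre differ by exactly that
sign (`LiftTrivialization.toFun_smul`).

Conversely, if g on ordered configurations changes by the sign, then the vectors of the fibre over q
obtained from g x for the various orderings x of q all agree, and they form a section
(`LiftTrivialization.exists_section`). An L² function is first replaced by a representative that is
anti-symmetric everywhere, through the anti-symmetrizer. The section obtained is measurable because
measurability over the base can be tested after pulling back along `proj`
(`LiftTrivialization.measurableSection_iff`).

Norms match because the trivialization is unitary, collisions form a null set, and the N! sheets of
the covering cancel the squared prefactor 1/N!. Multiplication by the indicator of A commutes with
lifting pointwise. Indicator multiplication on L² is a projection-valued measure by countable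
additivity of the integral; this gives the property for `QAnti`, and it is carried to `QF` by U. -/

theorem contMDiffWithinAt_oconf_iff {β : ℝ → OConf d N} {s : Set ℝ} {t : ℝ} :
    ContMDiffWithinAt 𝓘(ℝ, ℝ) 𝓘(ℝ, Tup d N) ∞ β s t ↔
      ContMDiffWithinAt 𝓘(ℝ, ℝ) 𝓘(ℝ, Tup d N) ∞ (fun r => (β r).1) s t := by
  rw [contMDiffWithinAt_iff_target]
  refine ⟨fun h => h.2, fun h => ⟨?_, h⟩⟩
  exact tendsto_subtype_rng.2 h.continuousWithinAt

/-- The charts are local inverses of `proj`, so the chart applied to the projection of y returns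
some ordering of the points of y; by continuity the ordering is locally constant. -/
theorem exists_perm_chart_proj (x : OConf d N) : ∃ σ : Equiv.Perm (Fin N),
    ∀ᶠ y in 𝓝 x, chartAt (Tup d N) (proj x) (proj y) = y.1 ∘ σ := by
  set c := chartAt (Tup d N) (proj x) with hc
  have hcx : proj x ∈ c.source := mem_chart_source _ _
  have hemb : IsOpenEmbedding (Subtype.val : OConf d N → Tup d N) :=
    (oconfOpens d N).isOpenEmbedding'
  have hpc : Continuous (proj : OConf d N → UConf d N) := isLocalHomeomorph_proj.continuous
  have hs : IsOpen ((Subtype.val : OConf d N → Tup d N) '' (proj ⁻¹' c.source)) :=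
    hemb.isOpenMap _ (c.open_source.preimage hpc)
  -- `eventually_eq_comp_perm` needs a map on all tuples; the value at tuples with collisions is
  -- irrelevant.
  set T : Tup d N → Tup d N := fun z =>
    open Classical in if h : Function.Injective z then c (proj ⟨z, h⟩) else z with hT
  have hTv : ∀ y : OConf d N, T y.1 = c (proj y) := fun y => dif_pos y.2
  obtain ⟨σ, hσ⟩ := eventually_eq_comp_perm (T := T) (y := x.1) hs ⟨x, hcx, rfl⟩ (by
    rintro _ ⟨y, hy, rfl⟩
    refine ContinuousAt.continuousWithinAt ?_
    rw [← hemb.continuousAt_iff]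
    refine ((c.continuousAt hy).comp hpc.continuousAt).congr (Eventually.of_forall fun z => ?_)
    exact (hTv z).symm) (by
    rintro _ ⟨y, hy, rfl⟩
    exact y.2) (by
    rintro _ ⟨y, hy, rfl⟩
    obtain ⟨h, he⟩ := proj_chart_symm (chart_mem_atlas (Tup d N) (proj x)) (c.map_source hy)
    rw [c.left_inv hy] at he
    obtain ⟨τ, hτ⟩ := proj_eq_iff.1 he
    refine ⟨τ, ?_⟩
    rw [hTv]
    have := congrArg Subtype.val hτ
    rw [← this]
    funext i
    simp [perm_smul_val])
  refine ⟨σ, ?_⟩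
  filter_upwards [continuous_subtype_val.continuousAt.eventually hσ] with y hy
  rw [← hTv, hy]

/-- In the chart, `proj` is locally a relabelling of the coordinates, which is linear and hence
smooth. -/
theorem ContMDiffWithinAt.proj_comp {β : ℝ → OConf d N} {s : Set ℝ} {t : ℝ} (ht : t ∈ s)
    (h : ContMDiffWithinAt 𝓘(ℝ, ℝ) 𝓘(ℝ, Tup d N) ∞ β s t) :
    ContMDiffWithinAt 𝓘(ℝ, ℝ) 𝓘(ℝ, Tup d N) ∞ (fun r => proj (β r)) s t := by
  rw [contMDiffWithinAt_iff_target]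
  refine ⟨isLocalHomeomorph_proj.continuous.continuousAt.comp_continuousWithinAt
    h.continuousWithinAt, ?_⟩
  obtain ⟨σ, hσ⟩ := exists_perm_chart_proj (β t)
  have hL : ContDiff ℝ ∞ (fun z : Tup d N => z ∘ σ) :=
    contDiff_pi.2 fun i => contDiff_apply ℝ (Pt d) (σ i)
  have h2 := hL.contMDiff.contMDiffAt.comp_contMDiffWithinAt t (contMDiffWithinAt_oconf_iff.1 h)
  refine h2.congr_of_eventuallyEq_of_mem ?_ ht
  filter_upwards [h.continuousWithinAt.eventually hσ] with r hr
  exact hr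

/-- The path that runs along the segment from `x` to `z`, then along that from `z` to `y`. -/
noncomputable def brokenLine {E : Type*} [AddCommGroup E] [Module ℝ E] (x z y : E) (t : ℝ) : E :=
  if t ≤ 1 / 2 then x + (2 * t) • (z - x) else z + (2 * t - 1) • (y - z)

variable {E : Type*} [NormedAddCommGroup E] [NormedSpace ℝ E]

theorem brokenLine_zero (x z y : E) : brokenLine x z y 0 = x := by simp [brokenLine]

theorem brokenLine_one (x z y : E) : brokenLine x z y 1 = y := by
  norm_num [brokenLine]

theorem brokenLine_of_le (x z y : E) {t : ℝ} (ht : t ≤ 1 / 2) :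
    brokenLine x z y t = x + (2 * t) • (z - x) := if_pos ht

theorem brokenLine_of_ge (x z y : E) {t : ℝ} (ht : 1 / 2 ≤ t) :
    brokenLine x z y t = z + (2 * t - 1) • (y - z) := by
  rcases ht.lt_or_eq with h | rfl
  · exact if_neg (not_le.2 h)
  · norm_num [brokenLine]

/-- The partition of the unit interval into two halves. -/
noncomputable def halves : UnitPartition where
  n := 2
  t i := i / 2
  t_zero := by norm_num
  t_last := by norm_num
  t_lt i _ := by push_cast; linarith

/-- A real vector space is not a finite union of proper subspaces, and in dimension at least two a
line is proper. -/
theorem exists_notMem_lines (hd : 2 ≤ d) {ι : Type*} [Finite ι] (v : ι → Pt d) :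
    ∃ w : Pt d, ∀ i, w ∉ Submodule.span ℝ {v i} := by
  have key : ∀ i, (Submodule.span ℝ {v i} : Submodule ℝ (Pt d)) ≠ ⊤ := by
    intro i h
    have h1 := finrank_span_le_card (R := ℝ) ({v i} : Set (Pt d))
    rw [h, finrank_top, finrank_euclideanSpace_fin] at h1
    simp at h1
    omega
  have h : (⋃ i, ((Submodule.span ℝ {v i} : Submodule ℝ (Pt d)) : Set (Pt d))) ≠ univ := fun h => by
    obtain ⟨i, hi⟩ := Subspace.exists_eq_top_of_iUnion_eq_univ h
    exact key i hi
  obtain ⟨w, hw⟩ := (ne_univ_iff_exists_notMem _).1 h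
  simp only [mem_iUnion, not_exists, SetLike.mem_coe] at hw
  exact ⟨w, hw⟩

/-- A collision of particles i and j at parameter a means a(i - j)w = (a - 1)(xᵢ - xⱼ). For a ≠ 0
this puts w on a forbidden line; for a = 0 it is a collision in x. The target z places the particles
at equally spaced points of the line through w. -/
theorem injective_segment {x z : Tup d N} {w : Pt d} (hx : Function.Injective x)
    (hw : ∀ i j, w ∉ Submodule.span ℝ {x i - x j}) (hz : ∀ i : Fin N, z i = (i : ℝ) • w) (a : ℝ) :
    Function.Injective (x + a • (z - x)) := by
  intro i j hij
  by_contra hne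
  have hij' : (a * ((i : ℝ) - j)) • w = (a - 1) • (x i - x j) := by
    simp only [Pi.add_apply, Pi.smul_apply, Pi.sub_apply, hz] at hij
    rw [← sub_eq_zero] at hij ⊢
    rw [← hij]
    module
  by_cases ha : a = 0
  · subst ha
    simp only [zero_mul, zero_smul, zero_sub, neg_smul, one_smul] at hij'
    exact hne (hx (sub_eq_zero.1 (neg_eq_zero.1 hij'.symm)))
  · have hc : a * ((i : ℝ) - j) ≠ 0 := by
      refine mul_ne_zero ha (sub_ne_zero.2 fun h => hne (Fin.ext ?_))
      exact_mod_cast h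
    refine hw i j (Submodule.mem_span_singleton.2 ⟨(a * ((i : ℝ) - j))⁻¹ * (a - 1), ?_⟩)
    rw [mul_smul, ← hij', smul_smul, inv_mul_cancel₀ hc, one_smul]

/-- In dimension at least two the space of ordered configurations is connected by piecewise smooth
curves. -/
theorem exists_smoothOnPieces (hd : 2 ≤ d) (x y : OConf d N) :
    ∃ β : ℝ → OConf d N, SmoothOnPieces d N halves β ∧ β 0 = x ∧ β 1 = y := by
  -- One direction w avoids the difference lines of both endpoints, so the same intermediate
  -- configuration can be reached from x and from y.
  obtain ⟨w, hw⟩ := exists_notMem_lines hd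
    (fun p : (Fin N × Fin N) ⊕ (Fin N × Fin N) =>
      p.elim (fun p => x.1 p.1 - x.1 p.2) (fun p => y.1 p.1 - y.1 p.2))
  have hwx : ∀ i j, w ∉ Submodule.span ℝ {x.1 i - x.1 j} := fun i j => hw (.inl (i, j))
  have hwy : ∀ i j, w ∉ Submodule.span ℝ {y.1 i - y.1 j} := fun i j => hw (.inr (i, j))
  set z : Tup d N := fun i => (i : ℝ) • w with hz
  have hinj : ∀ t, Function.Injective (brokenLine x.1 z y.1 t) := by
    intro t
    rcases le_total t (1 / 2) with ht | ht
    · rw [brokenLine_of_le _ _ _ ht]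
      exact injective_segment x.2 hwx (fun _ => rfl) _
    · rw [brokenLine_of_ge _ _ _ ht]
      -- The second half is the segment from y to z run backwards.
      convert injective_segment y.2 hwy (z := z) (fun _ => rfl) (2 - 2 * t) using 1
      module
  refine ⟨fun t => ⟨_, hinj t⟩, ?_, Subtype.ext (brokenLine_zero _ _ _),
    Subtype.ext (brokenLine_one _ _ _)⟩
  intro i hi t ht
  refine contMDiffWithinAt_oconf_iff.2 (ContDiffWithinAt.contMDiffWithinAt ?_)
  change i < 2 at hi
  interval_cases i
  · refine ContDiffWithinAt.congr_of_mem (f := fun r : ℝ => x.1 + (2 * r) • (z - x.1)) ?_ ?_ ht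
    · exact ContDiff.contDiffWithinAt (by fun_prop)
    · intro r hr
      refine brokenLine_of_le _ _ _ (hr.2.trans_eq ?_)
      norm_num [halves]
  · refine ContDiffWithinAt.congr_of_mem (f := fun r : ℝ => z + (2 * r - 1) • (y.1 - z)) ?_ ?_ ht
    · exact ContDiff.contDiffWithinAt (by fun_prop)
    · intro r hr
      refine brokenLine_of_ge _ _ _ (le_trans (Eq.le ?_) hr.1)
      norm_num [halves]

end Curves

/-! ### The sign of a relabelling as a holonomy. -/

section Sign
variable {d N : ℕ} {F : HermitianLineBundle.{u} d N}

theorem proj_smul (σ : Equiv.Perm (Fin N)) (x : OConf d N) : proj (σ • x) = proj x :=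
  isQuotientCoveringMap_proj.map_smul σ

/-- The labelling of the points of an unordered configuration by an ordered one. -/
noncomputable def labelEquiv (x : OConf d N) : Fin N ≃ (proj x).1 :=
  (Equiv.ofInjective x.1 x.2).trans (Equiv.setCongr (by
    ext y
    exact mem_proj.symm))

theorem labelEquiv_apply (x : OConf d N) (i : Fin N) : (labelEquiv x i : Pt d) = x.1 i := rfl

/-- A curve from `x` to `σ • x` projects to a loop that defines a permutation conjugate to `σ⁻¹`. -/
theorem definesPerm_proj {σ : Equiv.Perm (Fin N)} {β : ℝ → OConf d N}
    (hc : ContinuousOn β (Icc 0 1)) (h1 : β 1 = σ • β 0) :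
    DefinesPerm (fun t => proj (β t)) ((labelEquiv (β 0)).permCongr σ⁻¹) := by
  refine ⟨fun p t => (β t).1 ((labelEquiv (β 0)).symm p), fun p => ?_, fun p => ?_, fun p => ?_,
    fun t _ => ?_⟩
  · exact (continuous_apply _).comp_continuousOn (continuous_subtype_val.comp_continuousOn hc)
  · change (β 0).1 ((labelEquiv (β 0)).symm p) = _
    rw [← labelEquiv_apply, Equiv.apply_symm_apply]
  -- The i-th particle ends where the particle labelled σ⁻¹ i began, by the convention for the
  -- action; this is where the inverse comes from.
  · change (β 1).1 ((labelEquiv (β 0)).symm p) = _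
    rw [Equiv.permCongr_apply, labelEquiv_apply, h1]
    rfl
  · ext y
    rw [Finset.mem_coe, mem_proj]
    exact ((labelEquiv (β 0)).symm.surjective.exists (p := fun i => (β t).1 i = y))

theorem SmoothOnPieces.continuousOn_halves {M : Type*} [TopologicalSpace M]
    [ChartedSpace (Tup d N) M] {β : ℝ → M} (h : SmoothOnPieces d N halves β) :
    ContinuousOn β (Icc 0 1) := by
  have h0 := (h 0 (by norm_num [halves])).continuousOn
  have h1 := (h 1 (by norm_num [halves])).continuousOn
  have hu : Icc (0 : ℝ) 1 = halves.piece 0 ∪ halves.piece 1 := by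
    ext t
    simp only [UnitPartition.piece, halves, mem_union, mem_Icc]
    norm_num
    grind
  rw [hu]
  exact h0.union_of_isClosed h1 isClosed_Icc isClosed_Icc

/-- A trivialization of the lift of a fermionic line bundle changes by the sign of the permutation
when the particles are relabelled. -/
theorem LiftTrivialization.toFun_smul (hd : 2 ≤ d) (hF : IsFermionic F) (I : LiftTrivialization F)
    (σ : Equiv.Perm (Fin N)) (x : OConf d N) (ψ : ∀ q, F.Fiber q) :
    I.toFun (σ • x) (ψ (proj (σ • x))) =
      ((Equiv.Perm.sign σ : ℤ) : ℂ) * I.toFun x (ψ (proj x)) := by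
  obtain ⟨β, hβ, h0, h1⟩ := exists_smoothOnPieces hd x (σ • x)
  subst h0
  have hα : SmoothOnPieces d N halves (fun t => proj (β t)) := fun i hi t ht =>
    (hβ i hi t ht).proj_comp ht
  obtain ⟨s, hs, hs0, hs1⟩ := hF halves _ hα (by simp only [h1, proj_smul]) _
    (definesPerm_proj hβ.continuousOn_halves h1) (ψ (proj (β 0)))
  have hp := I.parallel halves β hβ s hs
  -- The start and the end of the loop are equal points but not definitionally so. Equality in the
  -- total space is turned into an equality in one fibre, with the section ψ naming the vector in
  -- both.
  have key : ∀ (q : UConf d N) (v : F.Fiber q) (c : ℂ),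
      TotalSpace.mk' ℂ q v = TotalSpace.mk' ℂ (proj (β 0)) (c • ψ (proj (β 0))) →
      v = c • ψ q := by
    intro q v c h
    obtain rfl : q = proj (β 0) := congrArg TotalSpace.proj h
    exact TotalSpace.mk_injective _ h
  have hk := key _ _ _ hs1
  rw [hk, hs0, map_smul, smul_eq_mul] at hp
  -- Stated for an arbitrary decidability instance, so that it applies to the classical one in
  -- `IsFermionic`.
  have hsign : ∀ [DecidableEq (proj (β 0)).1], ((Equiv.Perm.sign ((labelEquiv (β 0)).permCongr σ⁻¹) : ℤ) : ℂ) =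
      ((Equiv.Perm.sign σ : ℤ) : ℂ) := by
    intro _
    rw [Equiv.Perm.sign_permCongr, Equiv.Perm.sign_inv]
  have hsq : ((Equiv.Perm.sign σ : ℤ) : ℂ) * ((Equiv.Perm.sign σ : ℤ) : ℂ) = 1 := by
    rcases Int.units_eq_one_or (Equiv.Perm.sign σ) with h | h <;> simp [h]
  rw [← h1, ← hp]
  erw [hsign]
  rw [← mul_assoc, hsq, one_mul]
end Sign

/-! ### Measurability of sections through their lifts, and the measures on both configuration
spaces. -/

section Measurability
variable {d N : ℕ} {F : HermitianLineBundle.{u} d N}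

/-- The fibres of the quotient map are finite orbits. With second countability this makes the Borel
structure countably separated, as `measurable_comp_proj_iff` needs. -/
instance : T1Space (UConf d N) := by
  refine ⟨fun q => ?_⟩
  obtain ⟨x, rfl⟩ := proj_surjective q
  rw [← isQuotientMap_proj.isClosed_preimage]
  have : proj ⁻¹' {proj x} = range fun σ : Equiv.Perm (Fin N) => σ • x := by
    ext y
    exact proj_eq_iff
  rw [this]
  exact (finite_range _).isClosed

instance : StandardBorelSpace (OConf d N) :=
  (oconfOpens d N).isOpen.measurableSet.standardBorel

/-- A measurable surjection from a standard Borel space detects measurable sets: if a set has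
measurable preimage, then it and its complement are analytic, hence Borel. This replaces a choice of
measurable local orderings. -/
theorem measurable_comp_proj_iff {Y : Type*} [MeasurableSpace Y] {g : UConf d N → Y} :
    (Measurable fun x => g (proj x)) ↔ Measurable g :=
  measurable_proj.measurable_comp_iff_of_surjective proj_surjective

/-- A section is a multiple of the unit frame of a local trivialization. -/
theorem HermitianLineBundle.eq_smul_frame (e : Trivialization ℂ (π ℂ F.Fiber))
    [MemTrivializationAtlas e] (χ : ∀ q, F.Fiber q) {q : UConf d N} (hq : q ∈ e.baseSet) :
    χ q = (e ⟨q, χ q⟩).2 • e.symm q (1 : ℂ) := by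
  have h := e.symm_apply_apply_mk hq (χ q)
  have h2 := e.symm_apply_apply_mk hq ((e ⟨q, χ q⟩).2 • e.symm q (1 : ℂ))
  have h3 : (e ⟨q, (e ⟨q, χ q⟩).2 • e.symm q (1 : ℂ)⟩).2 = (e ⟨q, χ q⟩).2 := by
    refine ((e.linear ℂ hq).map_smul _ (e.symm q (1 : ℂ))).trans ?_
    rw [e.apply_mk_symm hq, smul_eq_mul, mul_one]
  rw [h3] at h2
  exact h.symm.trans h2

/-- The unit frame of a local trivialization is smooth. -/
theorem HermitianLineBundle.smoothSectionOn_frame (e : Trivialization ℂ (π ℂ F.Fiber))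
    [MemTrivializationAtlas e] :
    SmoothSectionOn F.Fiber (fun q => e.symm q (1 : ℂ)) e.baseSet := by
  refine (e.contMDiffOn_section_baseSet_iff (IB := 𝓘(ℝ, Tup d N)) (n := ∞)).2 ?_
  refine (contMDiffOn_const (c := (1 : ℂ))).congr fun q hq => ?_
  rw [e.apply_mk_symm hq]

open Classical in
/-- The unit frame of a local trivialization `e` of the bundle, read in the global trivialization
of the lift, and extended by zero. -/
noncomputable def LiftTrivialization.frame (I : LiftTrivialization F)
    (e : Trivialization ℂ (π ℂ F.Fiber)) : OConf d N → ℂ :=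
  (proj ⁻¹' e.baseSet).piecewise (fun x => I.toFun x (e.symm (proj x) (1 : ℂ))) 0

theorem measurableSet_proj_preimage_baseSet (e : Trivialization ℂ (π ℂ F.Fiber)) :
    MeasurableSet ((proj : OConf d N → UConf d N) ⁻¹' e.baseSet) :=
  measurable_proj e.open_baseSet.measurableSet

theorem LiftTrivialization.measurable_frame (I : LiftTrivialization F)
    (e : Trivialization ℂ (π ℂ F.Fiber)) [MemTrivializationAtlas e] : Measurable (I.frame e) :=
  open Classical in
  (I.smooth _ _ e.open_baseSet
    (HermitianLineBundle.smoothSectionOn_frame e)).continuousOn.measurable_piecewise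
    continuousOn_const (measurableSet_proj_preimage_baseSet e)

theorem LiftTrivialization.frame_of_mem (I : LiftTrivialization F)
    {e : Trivialization ℂ (π ℂ F.Fiber)} {x : OConf d N} (hx : proj x ∈ e.baseSet) :
    I.frame e x = I.toFun x (e.symm (proj x) (1 : ℂ)) := if_pos hx

theorem LiftTrivialization.frame_of_notMem (I : LiftTrivialization F)
    {e : Trivialization ℂ (π ℂ F.Fiber)} {x : OConf d N} (hx : proj x ∉ e.baseSet) :
    I.frame e x = 0 := if_neg hx

theorem LiftTrivialization.toFun_eq_mul_frame (I : LiftTrivialization F)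
    (e : Trivialization ℂ (π ℂ F.Fiber)) [MemTrivializationAtlas e] (χ : ∀ q, F.Fiber q)
    {x : OConf d N} (hx : proj x ∈ e.baseSet) :
    I.toFun x (χ (proj x)) = (e ⟨proj x, χ (proj x)⟩).2 * I.frame e x := by
  conv_lhs => rw [HermitianLineBundle.eq_smul_frame e χ hx]
  rw [map_smul, smul_eq_mul, I.frame_of_mem hx]

/-- The frame vector has coordinate 1 in `e`, and a unitary map is injective. This allows division
by the frame to recover local coordinates from the lift. -/
theorem LiftTrivialization.frame_ne_zero (I : LiftTrivialization F)
    (e : Trivialization ℂ (π ℂ F.Fiber)) [MemTrivializationAtlas e] {x : OConf d N}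
    (hx : proj x ∈ e.baseSet) : I.frame e x ≠ 0 := by
  rw [I.frame_of_mem hx]
  intro h
  have h0 : e.symm (proj x) (1 : ℂ) = 0 := (I.toFun x).map_eq_zero_iff.1 h
  have h1 := e.apply_mk_symm hx (1 : ℂ)
  rw [h0] at h1
  have h2 : (e ⟨proj x, (0 : F.Fiber (proj x))⟩).2 = 0 := (e.linear ℂ hx).map_zero
  rw [h1] at h2
  exact one_ne_zero h2

/-- A section is measurable if and only if its lift is measurable in a global trivialization. -/
theorem LiftTrivialization.measurableSection_iff (I : LiftTrivialization F)
    {ψ : ∀ q, F.Fiber q} :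
    MeasurableSection F ψ ↔ Measurable fun x => I.toFun x (ψ (proj x)) := by
  classical
  constructor
  · intro hψ
    obtain ⟨s, hs, hcov⟩ := TopologicalSpace.countable_cover_nhds
      (fun p : UConf d N => (trivializationAt ℂ F.Fiber p).open_baseSet.mem_nhds
        (FiberBundle.mem_baseSet_trivializationAt' p))
    have loc : ∀ p : UConf d N, Measurable fun x => I.frame (trivializationAt ℂ F.Fiber p) x *
        if proj x ∈ (trivializationAt ℂ F.Fiber p).baseSet then
          (trivializationAt ℂ F.Fiber p ⟨proj x, ψ (proj x)⟩).2 else 0 := by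
      intro p
      refine (I.measurable_frame _).mul ?_
      exact (Measurable.dite (hψ (trivializationAt ℂ F.Fiber p)) (measurable_const (a := (0 : ℂ)))
        (trivializationAt ℂ F.Fiber p).open_baseSet.measurableSet).comp measurable_proj
    intro T hT
    -- On each of countably many base sets the lift is the local coordinate times the frame.
    have : (fun x => I.toFun x (ψ (proj x))) ⁻¹' T = ⋃ p ∈ s,
        proj ⁻¹' (trivializationAt ℂ F.Fiber p).baseSet ∩
        (fun x => I.frame (trivializationAt ℂ F.Fiber p) x *
          if proj x ∈ (trivializationAt ℂ F.Fiber p).baseSet then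
          (trivializationAt ℂ F.Fiber p ⟨proj x, ψ (proj x)⟩).2 else 0) ⁻¹' T := by
      ext x
      have hx : proj x ∈ ⋃ p ∈ s, (trivializationAt ℂ F.Fiber p).baseSet := hcov ▸ mem_univ _
      simp only [mem_iUnion] at hx
      have key : ∀ p, proj x ∈ (trivializationAt ℂ F.Fiber p).baseSet →
          I.frame (trivializationAt ℂ F.Fiber p) x *
          (if proj x ∈ (trivializationAt ℂ F.Fiber p).baseSet then
          (trivializationAt ℂ F.Fiber p ⟨proj x, ψ (proj x)⟩).2 else 0) =
          I.toFun x (ψ (proj x)) := by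
        intro p hp
        rw [if_pos hp, I.toFun_eq_mul_frame _ ψ hp, mul_comm]
      simp only [mem_preimage, mem_iUnion, mem_inter_iff]
      constructor
      · intro h
        obtain ⟨p, hp, hxp⟩ := hx
        exact ⟨p, hp, hxp, by rwa [key p hxp]⟩
      · rintro ⟨p, hp, hxp, h⟩
        rwa [key p hxp] at h
    rw [this]
    exact .biUnion hs fun p _ => (measurableSet_proj_preimage_baseSet _).inter (loc p hT)
  · intro h e he
    have hg : Measurable fun q => if q ∈ e.baseSet then (e ⟨q, ψ q⟩).2 else 0 := by
      rw [← measurable_comp_proj_iff]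
      -- Off the base set the frame is 0, and division by zero gives exactly the zero extension of
      -- the coordinate.
      convert h.div (I.measurable_frame e) using 1
      funext x
      by_cases hx : proj x ∈ e.baseSet
      · rw [if_pos hx, Pi.div_apply, I.toFun_eq_mul_frame e ψ hx,
          mul_div_cancel_right₀ _ (I.frame_ne_zero e hx)]
      · rw [if_neg hx, Pi.div_apply, I.frame_of_notMem hx, div_zero]
    convert hg.comp measurable_subtype_coe using 1
    funext q
    exact (if_pos q.2).symm

/-- Almost all tuples are free of collisions. -/
theorem ae_injective (hd : 1 ≤ d) : ∀ᵐ x : Tup d N, Function.Injective x := by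
  have key : ∀ p : Fin N × Fin N, p.1 ≠ p.2 → ∀ᵐ x : Tup d N, x p.1 ≠ x p.2 := by
    intro p hp
    -- The collisions of two given particles form a linear subspace. It is proper, because one
    -- particle can be put at a unit vector and all others at the origin; hence it is null.
    have h := Measure.addHaar_submodule (volume : Measure (Tup d N))
      (LinearMap.ker ((LinearMap.proj p.1 : Tup d N →ₗ[ℝ] Pt d) - LinearMap.proj p.2)) (by
        intro htop
        have h1 : Pi.single (M := fun _ : Fin N => Pt d) p.1 (EuclideanSpace.single ⟨0, hd⟩ (1 : ℝ)) ∈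
            LinearMap.ker ((LinearMap.proj p.1 : Tup d N →ₗ[ℝ] Pt d) - LinearMap.proj p.2) :=
          htop ▸ Submodule.mem_top
        rw [LinearMap.mem_ker, LinearMap.sub_apply, LinearMap.proj_apply, LinearMap.proj_apply,
          Pi.single_eq_same, Pi.single_eq_of_ne hp.symm, sub_zero] at h1
        simp at h1)
    rw [ae_iff]
    convert h using 2
    ext x
    simp [sub_eq_zero]
  have := (ae_all_iff (μ := (volume : Measure (Tup d N)))
    (p := fun x (p : Fin N × Fin N) => p.1 ≠ p.2 → x p.1 ≠ x p.2)).2 (fun p => by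
      by_cases hp : p.1 = p.2
      · simp [hp]
      · simpa [hp] using key p hp)
  filter_upwards [this] with x hx i j hij
  by_contra hne
  exact hx (i, j) hne hij

theorem measurePreserving_val (hd : 1 ≤ d) :
    MeasurePreserving (Subtype.val : OConf d N → Tup d N) volume volume := by
  refine ⟨measurable_subtype_coe, ?_⟩
  change Measure.map Subtype.val (Measure.comap Subtype.val (volume : Measure (Tup d N))) = _
  rw [measurableEmbedding_val.map_comap]
  refine Measure.restrict_eq_self_of_ae_mem ?_
  filter_upwards [ae_injective hd] with x hx
  exact ⟨⟨x, hx⟩, rfl⟩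

theorem measurePreserving_proj : MeasurePreserving (proj : OConf d N → UConf d N) volume
    ((N.factorial : ENNReal) • volume) := by
  refine ⟨measurable_proj, ?_⟩
  change _ = (N.factorial : ENNReal) • ((N.factorial : ENNReal)⁻¹) •
    Measure.map proj (volume : Measure (OConf d N))
  rw [smul_smul, ENNReal.mul_inv_cancel (by simp [Nat.factorial_ne_zero]) (by simp), one_smul]

end Measurability

/-! ### Indicator multiplication on L² as a projection-valued measure. -/

section PVM

/-- In an inner product space a vector is the sum of orthogonal components as soon as the squares of
their norms add up to the square of its norm. -/
theorem hasSum_of_orthogonal {H ι : Type*} [NormedAddCommGroup H] [InnerProductSpace ℂ H]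
    {g : H} {f : ι → H} (hf : Pairwise fun i j => (inner ℂ (f i) (f j) : ℂ) = 0)
    (hg : ∀ i, (inner ℂ g (f i) : ℂ) = inner ℂ (f i) (f i))
    (hs : HasSum (fun i => (inner ℂ (f i) (f i) : ℂ)) (inner ℂ g g)) : HasSum f g := by
  classical
  -- Both cross terms and the square of the partial sum equal the same sum, so the squared distance
  -- is the missing norm mass. No completeness is needed.
  have key : ∀ s : Finset ι, ((‖∑ i ∈ s, f i - g‖ ^ 2 : ℝ) : ℂ) =
      inner ℂ g g - ∑ i ∈ s, inner ℂ (f i) (f i) := by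
    intro s
    have h1 : (inner ℂ g (∑ i ∈ s, f i) : ℂ) = ∑ i ∈ s, inner ℂ (f i) (f i) := by
      rw [inner_sum]
      exact Finset.sum_congr rfl fun i _ => hg i
    have h2 : (inner ℂ (∑ i ∈ s, f i) g : ℂ) = ∑ i ∈ s, inner ℂ (f i) (f i) := by
      rw [sum_inner]
      refine Finset.sum_congr rfl fun i _ => ?_
      rw [← inner_conj_symm, hg, inner_conj_symm]
    have h3 : (inner ℂ (∑ i ∈ s, f i) (∑ i ∈ s, f i) : ℂ) = ∑ i ∈ s, inner ℂ (f i) (f i) := by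
      rw [sum_inner]
      refine Finset.sum_congr rfl fun i hi => ?_
      rw [inner_sum, Finset.sum_eq_single i (fun j _ hj => hf hj.symm) (fun h => absurd hi h)]
    have h4 := inner_self_eq_norm_sq_to_K (𝕜 := ℂ) (∑ i ∈ s, f i - g)
    rw [inner_sub_sub_self, h1, h2, h3] at h4
    push_cast
    refine Eq.trans h4.symm ?_
    ring
  have h0 : Tendsto (fun s : Finset ι => ‖∑ i ∈ s, f i - g‖ ^ 2) atTop (𝓝 0) := by
    have h : Tendsto (fun s : Finset ι => (inner ℂ g g - ∑ i ∈ s, inner ℂ (f i) (f i) : ℂ))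
        atTop (𝓝 0) := by
      have := (tendsto_const_nhds (x := (inner ℂ g g : ℂ))).sub hs
      rwa [sub_self] at this
    simp only [← key] at h
    exact tendsto_ofReal_iff.1 (by simpa using h)
  have h1 : Tendsto (fun s : Finset ι => ‖∑ i ∈ s, f i - g‖) atTop (𝓝 0) := by
    have := (Real.continuous_sqrt.tendsto 0).comp h0
    simpa [Function.comp_def, Real.sqrt_sq] using this
  exact tendsto_iff_norm_sub_tendsto_zero.2 h1

variable {X : Type*} [MeasurableSpace X] {μ : Measure X} {s t : Set X}

/-- Symmetry, orthogonality for disjoint sets and the norm sums for countable additivity are all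
read off from this formula. -/
theorem inner_lpMulIndicator (hs : MeasurableSet s) (ht : MeasurableSet t) (f g : Lp ℂ 2 μ) :
    (inner ℂ (lpMulIndicator hs f) (lpMulIndicator ht g) : ℂ) =
      ∫ x in s ∩ t, inner ℂ (f x) (g x) ∂μ := by
  rw [L2.inner_def, ← integral_indicator (hs.inter ht)]
  refine integral_congr_ae ?_
  filter_upwards [coeFn_lpIndicator hs f, coeFn_lpIndicator ht g] with x h1 h2
  change inner ℂ (lpIndicator hs f x) (lpIndicator ht g x) = _
  rw [h1, h2]
  by_cases hx : x ∈ s <;> by_cases hy : x ∈ t <;> simp [hx, hy]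

theorem lpMulIndicator_of_ae_mem (hs : MeasurableSet s) (h : ∀ᵐ x ∂μ, x ∈ s) (f : Lp ℂ 2 μ) :
    lpMulIndicator hs f = f := by
  refine Lp.ext ((coeFn_lpIndicator hs f).trans ?_)
  filter_upwards [h] with x hx
  exact indicator_of_mem hx _

theorem lpMulIndicator_idem (hs : MeasurableSet s) (f : Lp ℂ 2 μ) :
    lpMulIndicator hs (lpMulIndicator hs f) = lpMulIndicator hs f := by
  refine Lp.ext ((coeFn_lpIndicator hs (lpIndicator hs f)).trans
    (EventuallyEq.trans ?_ (coeFn_lpIndicator hs f).symm))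
  filter_upwards [coeFn_lpIndicator hs f] with x hx
  by_cases h : x ∈ s
  · rw [indicator_of_mem h, hx]
  · rw [indicator_of_notMem h, indicator_of_notMem h]

theorem lpMulIndicator_univ (f : Lp ℂ 2 μ) : lpMulIndicator (μ := μ) .univ f = f :=
  lpMulIndicator_of_ae_mem _ (ae_of_all _ mem_univ) f

theorem lpMulIndicator_symmetric (hs : MeasurableSet s) (f g : Lp ℂ 2 μ) :
    (inner ℂ (lpMulIndicator hs f) g : ℂ) = inner ℂ f (lpMulIndicator hs g) := by
  have h1 := inner_lpMulIndicator hs .univ f g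
  have h2 := inner_lpMulIndicator .univ hs f g
  rw [lpMulIndicator_univ] at h1 h2
  rw [h1, h2, inter_comm]

/-- The pieces are orthogonal, and their squared norms add up by countable additivity of the
integral of ‖f‖². -/
theorem hasSum_lpMulIndicator {A : ℕ → Set X} (hA : ∀ n, MeasurableSet (A n))
    (hd : Pairwise (Function.onFun Disjoint A)) (hU : MeasurableSet (⋃ n, A n)) (f : Lp ℂ 2 μ) :
    HasSum (fun n => lpMulIndicator (hA n) f) (lpMulIndicator hU f) := by
  refine hasSum_of_orthogonal (fun i j hij => ?_) (fun i => ?_) ?_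
  · change (inner ℂ _ _ : ℂ) = 0
    rw [inner_lpMulIndicator, (hd hij).inter_eq, setIntegral_empty]
  · rw [inner_lpMulIndicator, inner_lpMulIndicator, inter_self,
      inter_eq_self_of_subset_right (subset_iUnion A i)]
  · simp only [inner_lpMulIndicator, inter_self]
    exact hasSum_integral_iUnion hA hd (L2.integrable_inner f f).integrableOn

/-- A projection-valued measure can be transported along a unitary isomorphism. -/
theorem IsPVM.of_unitary {X : Type*} [MeasurableSpace X] {H K : Type*} [NormedAddCommGroup H]
    [InnerProductSpace ℂ H] [NormedAddCommGroup K] [InnerProductSpace ℂ K]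
    {Q : ∀ A : Set X, MeasurableSet A → H →L[ℂ] H} {R : ∀ A : Set X, MeasurableSet A → K →L[ℂ] K}
    (hR : IsPVM R) (U : H ≃ₗᵢ[ℂ] K) (h : ∀ A hA ψ, Q A hA ψ = U.symm (R A hA (U ψ))) :
    IsPVM Q where
  symmetric A hA φ ψ := by
    rw [← U.inner_map_map, ← U.inner_map_map φ, h, h, U.apply_symm_apply, U.apply_symm_apply,
      hR.symmetric]
  idempotent A hA ψ := by
    rw [h, h, U.apply_symm_apply, hR.idempotent]
  map_univ := by
    ext ψ
    rw [h, hR.map_univ]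
    exact U.symm_apply_apply ψ
  map_iUnion A hA hd ψ := by
    simp only [h]
    exact (hR.map_iUnion A hA hd (U ψ)).mapL U.symm.toContinuousLinearEquiv.toContinuousLinearMap

end PVM

/-! ### The projection-valued measure on anti-symmetric functions. -/

section AntiPVM
variable {d N : ℕ}

theorem lpMulIndicator_congr {X : Type*} [MeasurableSpace X] {μ : Measure X} {s t : Set X}
    (hs : MeasurableSet s) (ht : MeasurableSet t) (h : s = t) :
    lpMulIndicator (μ := μ) hs = lpMulIndicator ht := by
  subst h
  rfl

theorem projPreimage_iUnion (A : ℕ → Set (UConf d N)) :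
    projPreimage (⋃ n, A n) = ⋃ n, projPreimage (A n) := by
  simp only [projPreimage, preimage_iUnion, image_iUnion]

theorem disjoint_projPreimage {A B : Set (UConf d N)} (h : Disjoint A B) :
    Disjoint (projPreimage A) (projPreimage B) :=
  (disjoint_image_iff Subtype.val_injective).2 (h.preimage _)

theorem isPVM_QAnti (hd : 1 ≤ d) : IsPVM (QAnti d N) where
  symmetric A hA φ ψ := lpMulIndicator_symmetric (measurableSet_projPreimage hA) φ.1 ψ.1
  idempotent A hA ψ := Subtype.ext (lpMulIndicator_idem (measurableSet_projPreimage hA) ψ.1)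
  map_univ := by
    ext1 ψ
    -- The preimage of the whole space omits the collisions, so it is only almost all of ℝ^{Nd}.
    refine Subtype.ext (lpMulIndicator_of_ae_mem (measurableSet_projPreimage .univ) ?_ ψ.1)
    filter_upwards [ae_injective hd] with x hx
    exact ⟨⟨x, hx⟩, mem_univ _, rfl⟩
  map_iUnion A hA hdis ψ := by
    have h := hasSum_lpMulIndicator (fun n => measurableSet_projPreimage (hA n))
      (fun i j hij => disjoint_projPreimage (hdis hij))
      (.iUnion fun n => measurableSet_projPreimage (hA n)) ψ.1
    rw [lpMulIndicator_congr _ (measurableSet_projPreimage (.iUnion hA))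
      (projPreimage_iUnion A).symm] at h
    -- Convergence in the subspace is convergence in the ambient L² space.
    exact ((antiL2 d N).subtypeₗᵢ.isometry.isEmbedding.isInducing.hasSum_iff
      _ _).1 h

end AntiPVM

/-! ### The lift of sections as a unitary map, and the intertwining relation. -/

section Lift
variable {d N : ℕ} {F : HermitianLineBundle.{u} d N} (I : LiftTrivialization F)

theorem liftSection_val (ψ : ∀ q, F.Fiber q) (x : OConf d N) :
    liftSection I ψ x.1 =
      ((1 / Real.sqrt (N.factorial : ℝ) : ℝ) : ℂ) * I.toFun x (ψ (proj x)) := dif_pos x.2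

theorem liftSection_of_not_injective (ψ : ∀ q, F.Fiber q) {x : Tup d N}
    (hx : ¬ Function.Injective x) : liftSection I ψ x = 0 := dif_neg hx

theorem liftSection_add (φ ψ : ∀ q, F.Fiber q) :
    liftSection I (φ + ψ) = liftSection I φ + liftSection I ψ := by
  funext x
  by_cases hx : Function.Injective x
  · lift x to OConf d N using hx
    simp only [Pi.add_apply, liftSection_val, map_add, mul_add]
  · simp only [Pi.add_apply, liftSection_of_not_injective I _ hx, add_zero]

theorem liftSection_smul (c : ℂ) (ψ : ∀ q, F.Fiber q) :
    liftSection I (c • ψ) = c • liftSection I ψ := by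
  funext x
  by_cases hx : Function.Injective x
  · lift x to OConf d N using hx
    simp only [Pi.smul_apply, liftSection_val, map_smul, smul_eq_mul]
    ring
  · simp only [Pi.smul_apply, liftSection_of_not_injective I _ hx, smul_zero]

theorem norm_liftSection_val (ψ : ∀ q, F.Fiber q) (x : OConf d N) :
    ‖liftSection I ψ x.1‖ ^ 2 = (N.factorial : ℝ)⁻¹ * ‖ψ (proj x)‖ ^ 2 := by
  rw [liftSection_val, norm_mul, mul_pow, LinearIsometryEquiv.norm_map, Complex.norm_real,
    Real.norm_eq_abs, sq_abs, div_pow, Real.sq_sqrt (by positivity), one_pow, one_div]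

theorem measurable_liftSection {ψ : ∀ q, F.Fiber q} (hψ : MeasurableSection F ψ) :
    Measurable (liftSection I ψ) := by
  classical
  exact Measurable.dite (s := {x : Tup d N | Function.Injective x})
    (f := fun x => ((1 / Real.sqrt (N.factorial : ℝ) : ℝ) : ℂ) * I.toFun x (ψ (proj x)))
    ((I.measurableSection_iff.1 hψ).const_mul _) (measurable_const (a := (0 : ℂ)))
    (isOpen_injective d N).measurableSet

/-- Pointwise squared norms differ by the constant 1/N!, and the measures by the factor N!. One
direction makes U well defined, the other gives square-integrability of the section built from a
given function. -/
theorem memLp_liftSection_iff (hd : 1 ≤ d) {ψ : ∀ q, F.Fiber q} (hψ : MeasurableSection F ψ) :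
    MemLp (liftSection I ψ) 2 ↔ Integrable fun q => ‖ψ q‖ ^ 2 := by
  have hN : (N.factorial : ℝ)⁻¹ ≠ 0 := by positivity
  rw [memLp_two_iff_integrable_sq_norm (measurable_liftSection I hψ).aestronglyMeasurable,
    ← (measurePreserving_val hd).integrable_comp_emb measurableEmbedding_val]
  simp only [Function.comp_def, norm_liftSection_val]
  rw [integrable_const_mul_iff hN.isUnit]
  rw [← integrable_smul_measure (μ := (volume : Measure (UConf d N))) (c := (N.factorial : ENNReal))
    (by simp [Nat.factorial_ne_zero]) (by simp),
    ← measurePreserving_proj.integrable_comp hψ.normSq.aestronglyMeasurable]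
  rfl

theorem integral_norm_liftSection (hd : 1 ≤ d) {ψ : ∀ q, F.Fiber q} (hψ : MeasurableSection F ψ) :
    ∫ x, ‖liftSection I ψ x‖ ^ 2 = ∫ q, ‖ψ q‖ ^ 2 := by
  have hN : (N.factorial : ℝ) ≠ 0 := by positivity
  rw [← (measurePreserving_val hd).integral_comp measurableEmbedding_val]
  simp only [norm_liftSection_val]
  rw [integral_const_mul]
  have h := integral_map (μ := (volume : Measure (OConf d N))) measurable_proj.aemeasurable
    (f := fun q => ‖ψ q‖ ^ 2) hψ.normSq.aestronglyMeasurable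
  rw [← h, measurePreserving_proj.map_eq, integral_smul_measure]
  simp [hN]

theorem liftSection_comp_perm (hd : 2 ≤ d) (hF : IsFermionic F) (ψ : ∀ q, F.Fiber q)
    (σ : Equiv.Perm (Fin N)) (x : Tup d N) :
    liftSection I ψ (x ∘ σ) = ((Equiv.Perm.sign σ : ℤ) : ℂ) * liftSection I ψ x := by
  by_cases hx : Function.Injective x
  · lift x to OConf d N using hx
    have h : x.1 ∘ σ = (σ⁻¹ • x).1 := by rw [perm_smul_val, inv_inv]
    rw [h, liftSection_val, liftSection_val, I.toFun_smul hd hF, Equiv.Perm.sign_inv]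
    ring
  · rw [liftSection_of_not_injective I ψ hx, mul_zero, liftSection_of_not_injective]
    intro h
    exact hx ((σ.injective_comp x).1 h)

/-- Every anti-symmetric function on ordered configurations is the lift of a section. -/
theorem LiftTrivialization.exists_section (hd : 2 ≤ d) (hF : IsFermionic F) {g : OConf d N → ℂ}
    (hg : ∀ (σ : Equiv.Perm (Fin N)) x, g (σ • x) = ((Equiv.Perm.sign σ : ℤ) : ℂ) * g x) :
    ∃ ψ : ∀ q, F.Fiber q, ∀ x, I.toFun x (ψ (proj x)) = g x := by
  classical
  have key : ∀ q : UConf d N, ∃ χ : ∀ q, F.Fiber q, ∀ x, proj x = q →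
      I.toFun x (χ (proj x)) = g x := by
    intro q
    obtain ⟨y, rfl⟩ := proj_surjective q
    -- The value over the fibre is read off at one ordering y; g and the trivialization change by
    -- the same sign, so every other ordering gives the same vector. A whole section is used so that
    -- `toFun_smul` applies without casts.
    refine ⟨Function.update 0 (proj y) ((I.toFun y).symm (g y)), fun x hx => ?_⟩
    obtain ⟨σ, rfl⟩ := proj_eq_iff.1 hx
    change I.toFun (σ • y) (Function.update (0 : ∀ q, F.Fiber q) (proj y)
      ((I.toFun y).symm (g y)) (proj (σ • y))) = g (σ • y)
    rw [I.toFun_smul hd hF, hg, Function.update_self, LinearIsometryEquiv.apply_symm_apply]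
  choose χ hχ using key
  exact ⟨fun q => χ q q, fun x => hχ (proj x) x rfl⟩

/-- An anti-symmetric `L²` function has a measurable representative that is anti-symmetric
everywhere. -/
theorem exists_antisymmetric_representative (f : antiL2 d N) :
    ∃ g : Tup d N → ℂ, Measurable g ∧ g =ᵐ[volume] f.1 ∧
      ∀ (σ : Equiv.Perm (Fin N)) x, g (x ∘ σ) = ((Equiv.Perm.sign σ : ℤ) : ℂ) * g x := by
  have hsq : ∀ σ : Equiv.Perm (Fin N),
      ((Equiv.Perm.sign σ : ℤ) : ℂ) * ((Equiv.Perm.sign σ : ℤ) : ℂ) = 1 := by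
    intro σ
    rcases Int.units_eq_one_or (Equiv.Perm.sign σ) with h | h <;> simp [h]
  -- The anti-symmetrizer of the chosen representative: almost everywhere all N! terms equal f x.
  refine ⟨fun x => (N.factorial : ℂ)⁻¹ * ∑ σ : Equiv.Perm (Fin N),
    ((Equiv.Perm.sign σ : ℤ) : ℂ) * f.1 (x ∘ σ), ?_, ?_, fun τ x => ?_⟩
  · exact (Finset.measurable_sum _ fun σ _ => ((Lp.stronglyMeasurable f.1).measurable.comp
      (measurePreserving_perm σ).measurable).const_mul _).const_mul _
  · filter_upwards [ae_all_iff.2 f.2] with x hx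
    simp only [hx, ← mul_assoc, hsq, one_mul, Finset.sum_const, Finset.card_univ,
      Fintype.card_perm, Fintype.card_fin, nsmul_eq_mul]
    rw [mul_assoc, ← mul_assoc, inv_mul_cancel₀ (by simp [Nat.factorial_ne_zero]), one_mul]
  · rw [mul_left_comm, Finset.mul_sum]
    refine congrArg ((N.factorial : ℂ)⁻¹ * ·) ?_
    refine Fintype.sum_equiv (Equiv.mulLeft τ) _ _ fun σ => ?_
    rw [Equiv.coe_mulLeft, Equiv.Perm.sign_mul, ← mul_assoc, Units.val_mul, Int.cast_mul,
      ← mul_assoc, hsq, one_mul, Function.comp_assoc, Equiv.Perm.coe_mul]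

theorem memLp_liftSection (hd : 2 ≤ d) (ψ : SqIntSection F) : MemLp (liftSection I ψ) 2 :=
  (memLp_liftSection_iff I (one_le_two.trans hd) ψ.2.1).2 ψ.2.2

/-- The lift of square-integrable sections as an isometry. -/
noncomputable def liftIsometry (hd : 2 ≤ d) (hF : IsFermionic F) :
    SqIntSection F →ₗᵢ[ℂ] antiL2 d N where
  toFun ψ := ⟨(memLp_liftSection I hd ψ).toLp _, by
    intro σ
    have h := MemLp.coeFn_toLp (memLp_liftSection I hd ψ)
    filter_upwards [h, (measurePreserving_perm σ).quasiMeasurePreserving.ae_eq h] with x h1 h2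
    simp only [Function.comp_apply] at h2
    rw [h1, h2, liftSection_comp_perm I hd hF]⟩
  map_add' φ ψ := by
    refine Subtype.ext (Eq.trans ?_ (MemLp.toLp_add (memLp_liftSection I hd φ)
      (memLp_liftSection I hd ψ)))
    exact MemLp.toLp_congr (memLp_liftSection I hd (φ + ψ)) _ (EventuallyEq.of_eq (liftSection_add I φ ψ))
  map_smul' c ψ := by
    refine Subtype.ext (Eq.trans ?_ (MemLp.toLp_const_smul c (memLp_liftSection I hd ψ)))
    exact MemLp.toLp_congr (memLp_liftSection I hd (c • ψ)) _ (EventuallyEq.of_eq (liftSection_smul I c ψ))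
  norm_map' ψ := by
    rw [← sq_eq_sq₀ (norm_nonneg _) (norm_nonneg _), SqIntSection.norm_sq,
      ← integral_norm_liftSection I (one_le_two.trans hd) ψ.2.1]
    change ‖MemLp.toLp _ (memLp_liftSection I hd ψ)‖ ^ 2 = _
    rw [← inner_self_eq_norm_sq (𝕜 := ℂ), L2.inner_def, ← integral_re (L2.integrable_inner _ _)]
    refine integral_congr_ae ?_
    filter_upwards [MemLp.coeFn_toLp
      (memLp_liftSection I hd ψ)] with x hx
    rw [hx]
    exact inner_self_eq_norm_sq _

theorem coeFn_liftIsometry (hd : 2 ≤ d) (hF : IsFermionic F) (ψ : SqIntSection F) :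
    (liftIsometry I hd hF ψ : Lp ℂ 2 (volume : Measure (Tup d N))) =ᵐ[volume] liftSection I ψ :=
  MemLp.coeFn_toLp (memLp_liftSection I hd ψ)

/-- An everywhere anti-symmetric representative descends exactly to a section, whose measurability
and integrability are equivalent to those of its lift. -/
theorem liftIsometry_surjective (hd : 2 ≤ d) (hF : IsFermionic F) :
    Function.Surjective (liftIsometry I hd hF) := by
  intro f
  obtain ⟨g, hgm, hgf, hg⟩ := exists_antisymmetric_representative f
  -- The factor √N! undoes the prefactor in `liftSection`.
  obtain ⟨ψ, hψ⟩ := I.exists_section hd hF (g := fun x => (Real.sqrt (N.factorial : ℝ) : ℂ) * g x.1)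
    (fun σ x => by
      rw [perm_smul_val, hg, Equiv.Perm.sign_inv]
      ring)
  have hm : MeasurableSection F ψ := by
    rw [I.measurableSection_iff]
    simp only [hψ]
    exact (hgm.comp measurable_subtype_coe).const_mul _
  have hN : (Real.sqrt (N.factorial : ℝ) : ℂ) ≠ 0 :=
    Complex.ofReal_ne_zero.2 (Real.sqrt_ne_zero'.2 (by positivity))
  have hlift : liftSection I ψ =ᵐ[volume] f.1 := by
    filter_upwards [hgf, ae_injective (one_le_two.trans hd)] with x hx hinj
    lift x to OConf d N using hinj
    rw [liftSection_val, hψ, ← hx]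
    push_cast
    field_simp
  have hint : Integrable fun q => ‖ψ q‖ ^ 2 :=
    (memLp_liftSection_iff I (one_le_two.trans hd) hm).1 ((memLp_congr_ae hlift).2 (Lp.memLp f.1))
  refine ⟨⟨ψ, hm, hint⟩, Subtype.ext (Lp.ext ?_)⟩
  exact (coeFn_liftIsometry I hd hF _).trans hlift

/-- The unitary isomorphism of `L²(F)` with the anti-symmetric functions. -/
noncomputable def liftUnitary (hd : 2 ≤ d) (hF : IsFermionic F) :
    L2Section F ≃ₗᵢ[ℂ] antiL2 d N :=
  LinearIsometryEquiv.ofSurjective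
    { (SeparationQuotient.liftCLM (liftIsometry I hd hF).toContinuousLinearMap
        fun _ _ h => (h.map (liftIsometry I hd hF).continuous).eq :
          L2Section F →L[ℂ] antiL2 d N).toLinearMap with
      norm_map' := fun ψ => by
        obtain ⟨ψ, rfl⟩ := SeparationQuotient.surjective_mk ψ
        exact (liftIsometry I hd hF).norm_map ψ }
    fun f => by
      obtain ⟨ψ, hψ⟩ := liftIsometry_surjective I hd hF f
      exact ⟨SeparationQuotient.mk ψ, hψ⟩

/-- The trivialization is fibrewise linear, so the scalar 1_A(π(x)) passes through it; at
collision-free x this is the indicator of the preimage of A. -/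
theorem liftUnitary_QF (hd : 2 ≤ d) (hF : IsFermionic F) {A : Set (UConf d N)}
    (hA : MeasurableSet A) (ψ : L2Section F) :
    liftUnitary I hd hF (QF F A hA ψ) = QAnti d N A hA (liftUnitary I hd hF ψ) := by
  obtain ⟨ψ, rfl⟩ := SeparationQuotient.surjective_mk ψ
  change liftIsometry I hd hF (SqIntSection.mulIndicator A hA ψ) =
    QAnti d N A hA (liftIsometry I hd hF ψ)
  refine Subtype.ext (Lp.ext ((coeFn_liftIsometry I hd hF _).trans
    (EventuallyEq.trans ?_ (coeFn_lpIndicator (measurableSet_projPreimage hA) _).symm)))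
  filter_upwards [coeFn_liftIsometry I hd hF ψ, ae_injective (one_le_two.trans hd)] with x hx hinj
  lift x to OConf d N using hinj
  rw [liftSection_val]
  change _ * I.toFun x (A.indicator (1 : UConf d N → ℂ) (proj x) • ψ (proj x)) =
    (projPreimage A).indicator (liftIsometry I hd hF ψ).1 x.1
  by_cases h : proj x ∈ A
  · rw [indicator_of_mem (show x.1 ∈ projPreimage A from ⟨x, h, rfl⟩), hx, liftSection_val,
      indicator_of_mem h, Pi.one_apply, one_smul]
  · rw [indicator_of_notMem h, zero_smul, map_zero, mul_zero, indicator_of_notMem]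
    rintro ⟨y, hy, hyx⟩
    obtain rfl : y = x := Subtype.ext hyx
    exact h hy

end Lift

theorem mainTheorem7 {d N : ℕ} (hd : 2 ≤ d) (F : HermitianLineBundle.{u} d N)
    (hF : IsFermionic F) (I : LiftTrivialization F) :
    ∃ U : L2Section F ≃ₗᵢ[ℂ] antiL2 d N,
      (∀ ψ : SqIntSection F,
        ((U (SeparationQuotient.mk ψ) : Lp ℂ 2 (volume : Measure (Tup d N))) : Tup d N → ℂ)
          =ᵐ[volume] liftSection I ψ) ∧
      IsPVM (QF F) ∧ IsPVM (QAnti d N) ∧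
      ∀ (A : Set (UConf d N)) (hA : MeasurableSet A) (ψ : L2Section F),
        QF F A hA ψ = U.symm (QAnti d N A hA (U ψ)) := by
  have h : ∀ (A : Set (UConf d N)) (hA : MeasurableSet A) (ψ : L2Section F),
      QF F A hA ψ = (liftUnitary I hd hF).symm (QAnti d N A hA (liftUnitary I hd hF ψ)) := by
    intro A hA ψ
    rw [← liftUnitary_QF, LinearIsometryEquiv.symm_apply_apply]
  have hP : IsPVM (QAnti d N) := isPVM_QAnti (one_le_two.trans hd)
  exact ⟨liftUnitary I hd hF, coeFn_liftIsometry I hd hF, hP.of_unitary _ h, hP, h⟩
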